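/- Let $n\ge 0$ and let $\operatorname{Sym}_n^+$ be the manifold of real symmetric positive definite (SPD) $n\times n$ matrices, an open subset of the space $\operatorname{Sym}_n$ of symmetric matrices, equipped with one of the following Riemannian metrics $g\in\{le,lc,ai\}$, where $\mathbf P\in\operatorname{Sym}_n^+$, $\mathbf W,\mathbf V\in\operatorname{Sym}_n$, and $\langle\cdot,\cdot\rangle_F$ is the Frobenius inner product: - Log-Euclidean ($le$): $\langle \mathbf W,\mathbf V\rangle_{\mathbf P}=\langle D\log_{\mathbf P}(\mathbf W),D\log_{\mathbf P}(\mathbf V)\rangle_F$, where $\log$ is the matrix logarithm and $D\log_{\mathbf P}(\mathbf W)$ its directional derivative at $\mathbf P$ along $\mathbf W$; - Log-Cholesky ($lc$): $\langle \mathbf W,\mathbf V\rangle_{\mathbf P}=\langle\lfloor \mathbf X\rfloor,\lfloor \mathbf Y\rfloor\rangle_F+\langle \mathbb D(\mathbf L)^{-1}\mathbb D(\mathbf X),\mathbb D(\mathbf L)^{-1}\mathbb D(\mathbf Y)\rangle_F$, where $\mathbf L$ is the Cholesky factor of $\mathbf P$ (lower triangular, positive diagonal, $\mathbf L\mathbf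 L^T=\mathbf P$), $\mathbf X=\mathbf L(\mathbf L^{-1}\mathbf W\mathbf L^{-T})_{1/2}$, $\mathbf Y=\mathbf L(\mathbf L^{-1}\mathbf V\mathbf L^{-T})_{1/2}$, $\lfloor\cdot\rfloor$ is the strictly lower triangular part, $\mathbb D(\cdot)$ the diagonal part, and $(\cdot)_{1/2}$ the lower triangular part with the diagonal halved; - Affine-Invariant ($ai$): $\langle \mathbf W,\mathbf V\rangle_{\mathbf P}=\operatorname{tr}(\mathbf P^{-1}\mathbf W\mathbf P^{-1}\mathbf V)$. Let $\operatorname{Exp}$, $\operatorname{Log}$ and $\mathcal T_{\mathbf P\to\mathbf Q}$ be the Riemannian exponential map, the Riemannian logarithm, and parallel transport along the geodesic connecting $\mathbf P$ and $\mathbf Q$, for the Levi-Civita connection of the chosen metric, and let $\mathbf I$ be the identity matrix. Put $$\mathbf P\oplus_g\mathbf Q=\operatorname{Exp}_{\mathbf P}\big(\mathcal T_{\mathbf I\to\mathbf P}(\operatorname{Log}_{\mathbf I}(\mathbf Q))\big),\qquad \|\mathbf P\|=\sqrt{\langle\operatorname{Log}_{\mathbf I}(\mathbf P),\operatorname{Log}_{\mathbf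 I}(\mathbf P)\rangle_{\mathbf I}} .$$ Then every $\mathbf P\in\operatorname{Sym}_n^+$ has a unique left inverse $\ominus_g\mathbf P\in\operatorname{Sym}_n^+$, i.e. $\ominus_g\mathbf P\oplus_g\mathbf P=\mathbf I$, and the SPD inverse map $\mathbf P\mapsto\ominus_g\mathbf P$ preserves the SPD gyrodistance $d(\mathbf P,\mathbf Q)=\|\ominus_g\mathbf P\oplus_g\mathbf Q\|$: for all $\mathbf P,\mathbf Q\in\operatorname{Sym}_n^+$, $$d(\ominus_g\mathbf P,\ominus_g\mathbf Q)=d(\mathbf P,\mathbf Q).$$ -/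

import Mathlib

noncomputable section

namespace SPDGyro

open Matrix

/-- Real `n × n` matrices. Tangent vectors of the SPD manifold are the symmetric ones. -/
abbrev Mat (n : ℕ) : Type := Matrix (Fin n) (Fin n) ℝ

/-- The manifold of symmetric positive definite matrices, an open subset of the vector space of
symmetric matrices. -/
abbrev SPD (n : ℕ) : Type := {P : Mat n // P.PosDef}

/-- The identity matrix as a point of the SPD manifold. -/
def SPD.id (n : ℕ) : SPD n := ⟨1, Matrix.PosDef.one⟩

instance (n : ℕ) : Nonempty (SPD n) := ⟨SPD.id n⟩

/-- The Frobenius inner product of matrices. -/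
def frob {n : ℕ} (A B : Mat n) : ℝ := (Aᵀ * B).trace

/-! ### Riemannian geometry on the SPD manifold, in its global chart -/

/-- A Riemannian metric in the global chart: `g P W V` is the inner product at `P` of the tangent
vectors `W` and `V`. Only values at SPD `P` and symmetric `W`, `V` matter. -/
abbrev RMetric (n : ℕ) : Type := Mat n → Mat n → Mat n → ℝ

/-- The directional derivative at `P`, in direction `Z`, of the coefficient `P ↦ g P W V`. -/
def dMetric {n : ℕ} (g : RMetric n) (P Z W V : Mat n) : ℝ :=
  deriv (fun t : ℝ => g (P + t • Z) W V) 0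

/-- The Christoffel symbols of the first kind of the Levi-Civita connection: in the global chart,
`⟨∇_W V, Z⟩_P = christoffel g P W V Z` for constant vector fields `W`, `V`, `Z`. -/
def christoffel {n : ℕ} (g : RMetric n) (P W V Z : Mat n) : ℝ :=
  (dMetric g P W V Z + dMetric g P V W Z - dMetric g P Z W V) / 2

/-- A curve in the SPD manifold, seen as a curve of matrices. -/
def curve {n : ℕ} (γ : ℝ → SPD n) : ℝ → Mat n := fun t => (γ t).1

/-- The vector field `V` is parallel along the curve `γ` for the Levi-Civita connection: its
covariant derivative along `γ` (tested against all tangent vectors `Z`) vanishes. -/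
def IsParallelAlong {n : ℕ} (g : RMetric n) (γ : ℝ → SPD n) (V : ℝ → Mat n) : Prop :=
  Differentiable ℝ (curve γ) ∧ Differentiable ℝ V ∧ (∀ t, (V t).IsSymm) ∧
    ∀ t, ∀ Z : Mat n, Z.IsSymm →
      g (γ t).1 (deriv V t) Z + christoffel g (γ t).1 (deriv (curve γ) t) (V t) Z = 0

/-- Geodesics: curves whose velocity field is parallel. -/
def IsGeodesic {n : ℕ} (g : RMetric n) (γ : ℝ → SPD n) : Prop :=
  IsParallelAlong g γ (deriv (curve γ))

/-- The Riemannian exponential map: `riemExp g P W = γ 1` for the geodesic `γ` with `γ 0 = P` and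
initial velocity `W`. -/
def riemExp {n : ℕ} (g : RMetric n) (P : SPD n) (W : Mat n) : SPD n :=
  Classical.epsilon fun R =>
    ∃ γ : ℝ → SPD n, IsGeodesic g γ ∧ γ 0 = P ∧ deriv (curve γ) 0 = W ∧ γ 1 = R

/-- The Riemannian logarithm: the tangent vector at `P` that the exponential map at `P` sends
to `Q`. -/
def riemLog {n : ℕ} (g : RMetric n) (P Q : SPD n) : Mat n :=
  Classical.epsilon fun W => W.IsSymm ∧ riemExp g P W = Q

/-- Parallel transport of the tangent vector `W` from `P` to `Q` along the geodesic connecting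
`P` and `Q`. -/
def transport {n : ℕ} (g : RMetric n) (P Q : SPD n) (W : Mat n) : Mat n :=
  Classical.epsilon fun W' =>
    ∃ (γ : ℝ → SPD n) (V : ℝ → Mat n), IsGeodesic g γ ∧ γ 0 = P ∧ γ 1 = Q ∧
      IsParallelAlong g γ V ∧ V 0 = W ∧ V 1 = W'

/-! ### The Log-Euclidean, Log-Cholesky and Affine-Invariant metrics -/

/-- The usual logarithm of an SPD matrix. -/
def matLog {n : ℕ} (P : Mat n) : Mat n := cfc Real.log P

/-- The directional derivative of the matrix logarithm at `P` along `W`. -/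
def dLog {n : ℕ} (P W : Mat n) : Mat n := deriv (fun t : ℝ => matLog (P + t • W)) 0

/-- The Log-Euclidean metric. -/
def metricLE (n : ℕ) : RMetric n := fun P W V => frob (dLog P W) (dLog P V)

/-- The strictly lower triangular part of a matrix. -/
def strictLower {n : ℕ} (A : Mat n) : Mat n := Matrix.of fun i j => if j < i then A i j else 0

/-- The diagonal part of a matrix. -/
def diagPart {n : ℕ} (A : Mat n) : Mat n := Matrix.diagonal fun i => A i i

/-- The lower triangular part of a matrix with the diagonal entries halved. -/
def lowerHalf {n : ℕ} (A : Mat n) : Mat n := strictLower A + (1 / 2 : ℝ) • diagPart A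

/-- `L` is a Cholesky factor of `P`: it is lower triangular, has positive diagonal entries, and
satisfies `P = L Lᵀ`. -/
def IsCholesky {n : ℕ} (P L : Mat n) : Prop :=
  (∀ i j, i < j → L i j = 0) ∧ (∀ i, 0 < L i i) ∧ L * Lᵀ = P

/-- The Cholesky factor of an SPD matrix. -/
def chol {n : ℕ} (P : Mat n) : Mat n := Classical.epsilon (IsCholesky P)

/-- The metric on the manifold of lower triangular matrices with positive diagonal entries from
which the Log-Cholesky metric is pulled back. -/
def metricCholesky {n : ℕ} (L X Y : Mat n) : ℝ :=
  frob (strictLower X) (strictLower Y) +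
    frob ((diagPart L)⁻¹ * diagPart X) ((diagPart L)⁻¹ * diagPart Y)

/-- The differential of the Cholesky map, in terms of the Cholesky factor `L` of the base point:
`W ↦ L (L⁻¹ W L⁻ᵀ)_{1/2}`. -/
def dChol {n : ℕ} (L W : Mat n) : Mat n := L * lowerHalf (L⁻¹ * W * (L⁻¹)ᵀ)

/-- The Log-Cholesky metric. -/
def metricLC (n : ℕ) : RMetric n := fun P W V =>
  metricCholesky (chol P) (dChol (chol P) W) (dChol (chol P) V)

/-- The Affine-Invariant metric. -/
def metricAI (n : ℕ) : RMetric n := fun P W V => (P⁻¹ * W * P⁻¹ * V).trace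

/-- The three geometries `le`, `lc`, `ai` considered on the SPD manifold. -/
inductive Geometry : Type
  | le
  | lc
  | ai

/-- The Riemannian metric of each of the three geometries. -/
def Geometry.metric (k : Geometry) (n : ℕ) : RMetric n :=
  match k with
  | .le => metricLE n
  | .lc => metricLC n
  | .ai => metricAI n

/-! ### Gyrovector operations, gyrodistance and gyroisometries -/

/-- `P ⊕ Q = Exp_P (T_{I → P} (Log_I Q))`. -/
def gyroAdd {n : ℕ} (g : RMetric n) (P Q : SPD n) : SPD n :=
  riemExp g P (transport g (SPD.id n) P (riemLog g (SPD.id n) Q))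

/-- `⊖ P`: the left inverse of `P`, characterised by `⊖ P ⊕ P = I`. This is the SPD inverse map. -/
def gyroNeg {n : ℕ} (g : RMetric n) (P : SPD n) : SPD n :=
  Classical.epsilon fun R => gyroAdd g R P = SPD.id n

/-- The SPD inner product `⟨P, Q⟩ = ⟨Log_I P, Log_I Q⟩_I`. -/
def spdInner {n : ℕ} (g : RMetric n) (P Q : SPD n) : ℝ :=
  g (SPD.id n).1 (riemLog g (SPD.id n) P) (riemLog g (SPD.id n) Q)

/-- The SPD norm induced by the SPD inner product. -/
def spdNorm {n : ℕ} (g : RMetric n) (P : SPD n) : ℝ := Real.sqrt (spdInner g P P)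

/-- The SPD gyrodistance `d(P, Q) = ‖⊖ P ⊕ Q‖`. -/
def gyroDist {n : ℕ} (g : RMetric n) (P Q : SPD n) : ℝ := spdNorm g (gyroAdd g (gyroNeg g P) Q)

/-- SPD gyroisometries: maps preserving the SPD gyrodistance. -/
def IsGyroisometry {n : ℕ} (g : RMetric n) (ω : SPD n → SPD n) : Prop :=
  ∀ P Q : SPD n, gyroDist g (ω P) (ω Q) = gyroDist g P Q

end SPDGyro

end

/-!
A map `inv` with `R ⊕ P = I ↔ R = inv P` that is an automorphism of `⊕` and preserves the norm is
automatically a gyroisometry: `inv (inv P) ⊕ inv Q = inv (inv P ⊕ Q)` has the norm of `inv P ⊕ Q`.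

For the Log-Euclidean and the Log-Cholesky metrics, the manifold is isometric to a vector space with
a constant inner product, through `X ↦ exp X` for symmetric `X` and `T ↦ L Lᵀ` for lower triangular
`T`, where `L` is `T` with its diagonal exponentiated. Both send `0` to `I`, so there `⊕` is vector
addition, `inv` is negation and the claims are clear.

For the Affine-Invariant metric, `γ` is a geodesic precisely when `C = γ⁻¹ γ'` is constant. Since
`γ C` is symmetric, the equation for a parallel field along `γ` is `V' = (Cᵀ V + V C) / 2`, solved
by `V t = exp(tC/2)ᵀ (V 0) exp(tC/2)`, and `γ` itself solves the same equation. Hence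
`P ⊕ Q = √P Q √P`, and `P ↦ P⁻¹` is an automorphism, which preserves the norm because
`log P⁻¹ = -log P`.
-/

noncomputable section

namespace SPDGyro

open Matrix NormedSpace Filter Topology Set
open scoped Matrix.Norms.L2Operator MatrixOrder

variable {n : ℕ} {E : Type*} [NormedAddCommGroup E] [NormedSpace ℝ E]

lemma epsilon_eq {α : Type*} [Nonempty α] {p : α → Prop} {a : α} (hp : ∀ x, p x ↔ x = a) :
    Classical.epsilon p = a :=
  (hp _).mp (Classical.epsilon_spec ⟨a, (hp a).mpr rfl⟩)

lemma hasDerivAt_add_smul (x v : E) (t : ℝ) : HasDerivAt (fun s : ℝ => x + s • v) v t := by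
  simpa using ((hasDerivAt_id t).smul_const v).const_add x

lemma eq_add_smul_of_hasDerivAt {x : ℝ → E} {v : E} (hx : ∀ t, HasDerivAt x v t) (t : ℝ) :
    x t = x 0 + t • v := by
  have hderiv (s : ℝ) : HasDerivAt (fun s => x s - s • v) 0 s := by
    simpa using (hx s).fun_sub ((hasDerivAt_id s).smul_const v)
  have := is_const_of_deriv_eq_zero (fun s => (hderiv s).differentiableAt)
    (fun s => (hderiv s).deriv) t 0
  rwa [zero_smul, sub_zero, sub_eq_iff_eq_add] at this

/-! ### Symmetric matrices -/

/-- The space `Sym_n` of symmetric matrices: the tangent space of the SPD manifold at each point. -/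
def symSubmodule (n : ℕ) : Submodule ℝ (Mat n) where
  carrier := {A | A.IsSymm}
  add_mem' := IsSymm.add
  zero_mem' := isSymm_zero
  smul_mem' c _ hA := hA.smul c

instance : CompleteSpace (symSubmodule n) := FiniteDimensional.complete ℝ _

/-- The symmetric part `(A + Aᵀ) / 2` of a matrix. It is used to lift curves of symmetric matrices
to curves in `symSubmodule n`. -/
def symPart (n : ℕ) : Mat n →L[ℝ] symSubmodule n :=
  LinearMap.toContinuousLinearMap
    { toFun A := ⟨(1 / 2 : ℝ) • (A + Aᵀ), (isSymm_add_transpose_self A).smul _⟩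
      map_add' A B := Subtype.ext <| by
        simp only [transpose_add, Submodule.coe_add]
        module
      map_smul' c A := Subtype.ext <| by
        simp only [transpose_smul, RingHom.id_apply, Submodule.coe_smul]
        module }

lemma coe_symPart {A : Mat n} (hA : A.IsSymm) : (symPart n A : Mat n) = A := by
  change (1 / 2 : ℝ) • (A + Aᵀ) = A
  rw [hA.eq]
  module

lemma symPart_coe (A : symSubmodule n) : symPart n A = A := Subtype.ext (coe_symPart A.2)

lemma hasDerivAt_coe_symSubmodule {V : ℝ → symSubmodule n} {V' : symSubmodule n} {t : ℝ}
    (hV : HasDerivAt V V' t) : HasDerivAt (fun s => (V s : Mat n)) V' t :=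
  (symSubmodule n).subtypeL.hasFDerivAt.comp_hasDerivAt t hV

lemma differentiable_coe_symSubmodule {V : ℝ → symSubmodule n} :
    (Differentiable ℝ fun t => (V t : Mat n)) ↔ Differentiable ℝ V := by
  refine ⟨fun hV => ?_, (symSubmodule n).subtypeL.differentiable.comp⟩
  simpa only [Function.comp_def, symPart_coe] using (symPart n).differentiable.comp hV

lemma coe_fderiv_eq_of_hasDerivAt {Ψ : E → symSubmodule n} {x y : E} {M : Mat n}
    (hΨ : DifferentiableAt ℝ Ψ x) (hM : HasDerivAt (fun t : ℝ => (Ψ (x + t • y) : Mat n)) M 0) :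
    (fderiv ℝ Ψ x y : Mat n) = M :=
  (hasDerivAt_coe_symSubmodule <| hΨ.hasFDerivAt.comp_hasDerivAt_of_eq 0
    (hasDerivAt_add_smul x y 0) (by simp)).unique hM

lemma isSymm_of_posDef {P : Mat n} (hP : P.PosDef) : P.IsSymm :=
  isHermitian_iff_isSymm.mp hP.isHermitian

lemma posDef_mul_mul_transpose {P L : Mat n} (hP : P.PosDef) (hL : IsUnit L) :
    (L * P * Lᵀ).PosDef := by
  rw [← conjTranspose_eq_transpose_of_trivial]
  exact hL.posDef_star_right_conjugate_iff.mpr hP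

/-- An SPD matrix as an element of the vector space `Sym_n`. -/
def SPD.toSym (P : SPD n) : symSubmodule n := ⟨P.1, isSymm_of_posDef P.2⟩

lemma SPD.toSym_injective : Function.Injective (SPD.toSym (n := n)) := fun _ _ h =>
  Subtype.ext (congrArg (fun X : symSubmodule n => (X : Mat n)) h)

/-! ### Automorphic inverses -/

/-- `inv` is the left inverse map of the gyroaddition of the metric `g`, it is an automorphism of
the gyroaddition, and it preserves the SPD norm. This is what makes `⊖` a gyroisometry. -/
structure IsAutomorphicInverse (g : RMetric n) (inv : SPD n → SPD n) : Prop where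
  gyroAdd_eq_id_iff (R P : SPD n) : gyroAdd g R P = SPD.id n ↔ R = inv P
  map_gyroAdd (P Q : SPD n) : inv (gyroAdd g P Q) = gyroAdd g (inv P) (inv Q)
  spdNorm_map (P : SPD n) : spdNorm g (inv P) = spdNorm g P

namespace IsAutomorphicInverse

variable {g : RMetric n} {inv : SPD n → SPD n}

lemma existsUnique_gyroAdd_eq_id (h : IsAutomorphicInverse g inv) (P : SPD n) :
    ∃! R, gyroAdd g R P = SPD.id n := by
  simp only [h.gyroAdd_eq_id_iff, existsUnique_eq]

lemma gyroNeg_eq (h : IsAutomorphicInverse g inv) : gyroNeg g = inv :=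
  funext fun P => epsilon_eq fun R => h.gyroAdd_eq_id_iff R P

lemma isGyroisometry_gyroNeg (h : IsAutomorphicInverse g inv) :
    IsGyroisometry g (gyroNeg g) := by
  intro P Q
  rw [gyroDist, gyroDist, h.gyroNeg_eq, ← h.map_gyroAdd, h.spdNorm_map]

end IsAutomorphicInverse

/-! ### Global parametrizations of the SPD manifold -/

/-- `Ψ` is a global `C²` parametrization of the SPD manifold by the vector space `E`. -/
structure IsGlobalParametrization (Ψ : E → symSubmodule n) : Prop where
  contDiff : ContDiff ℝ 2 Ψ
  injective : Function.Injective Ψ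
  range_eq : range Ψ = {P | P.1.PosDef}
  bijective_fderiv (x : E) : Function.Bijective (fderiv ℝ Ψ x)

namespace IsGlobalParametrization

variable {Ψ : E → symSubmodule n}

lemma fderiv_coe_injective (h : IsGlobalParametrization Ψ) (x : E) :
    Function.Injective fun y => (fderiv ℝ Ψ x y : Mat n) :=
  Subtype.val_injective.comp (h.bijective_fderiv x).1

variable [CompleteSpace E]

/-- The differential of a global parametrization at `x`, as an isomorphism from `E` to `Sym_n`. -/
def fderivEquiv (h : IsGlobalParametrization Ψ) (x : E) : E ≃L[ℝ] symSubmodule n :=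
  ContinuousLinearEquiv.ofBijective (fderiv ℝ Ψ x)
    (LinearMap.ker_eq_bot.mpr (h.bijective_fderiv x).1)
    (LinearMap.range_eq_top.mpr (h.bijective_fderiv x).2)

lemma hasStrictFDerivAt (h : IsGlobalParametrization Ψ) (x : E) :
    HasStrictFDerivAt Ψ (h.fderivEquiv x : E →L[ℝ] symSubmodule n) x :=
  h.contDiff.contDiffAt.hasStrictFDerivAt two_ne_zero

lemma isOpenEmbedding (h : IsGlobalParametrization Ψ) : IsOpenEmbedding Ψ :=
  .of_continuous_injective_isOpenMap h.contDiff.continuous h.injective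
    (isOpenMap_of_hasStrictFDerivAt_equiv h.hasStrictFDerivAt)

/-- The global chart inverse to a global parametrization. Outside the SPD matrices its values are
junk. -/
def chart (h : IsGlobalParametrization Ψ) : symSubmodule n → E :=
  (h.isOpenEmbedding.toOpenPartialHomeomorph Ψ).symm

lemma chart_apply (h : IsGlobalParametrization Ψ) (x : E) : h.chart (Ψ x) = x :=
  h.isOpenEmbedding.toOpenPartialHomeomorph_left_inv

lemma contDiffAt_chart (h : IsGlobalParametrization Ψ) (x : E) :
    ContDiffAt ℝ 2 h.chart (Ψ x) := by
  have hx := h.chart_apply x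
  refine OpenPartialHomeomorph.contDiffAt_symm (h.isOpenEmbedding.toOpenPartialHomeomorph Ψ)
    (f₀' := h.fderivEquiv x) (by simp) ?_ h.contDiff.contDiffAt
  change HasFDerivAt Ψ _ (h.chart (Ψ x))
  rw [hx]
  exact (h.hasStrictFDerivAt x).hasFDerivAt

lemma hasFDerivAt_chart (h : IsGlobalParametrization Ψ) (x : E) :
    HasFDerivAt h.chart ((h.fderivEquiv x).symm : symSubmodule n →L[ℝ] E) (Ψ x) :=
  HasFDerivAt.of_local_left_inverse (h.contDiffAt_chart x).continuousAt
    (by rw [h.chart_apply]; exact (h.hasStrictFDerivAt x).hasFDerivAt)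
    (by
      filter_upwards [h.isOpenEmbedding.isOpen_range.mem_nhds (mem_range_self x)]
      rintro _ ⟨y, rfl⟩
      rw [h.chart_apply])

lemma fderiv_chart (h : IsGlobalParametrization Ψ) (x : E) :
    fderiv ℝ h.chart (Ψ x) = (h.fderivEquiv x).symm :=
  (h.hasFDerivAt_chart x).fderiv

lemma apply_chart (h : IsGlobalParametrization Ψ) {P : symSubmodule n} (hP : P.1.PosDef) :
    Ψ (h.chart P) = P := by
  obtain ⟨x, rfl⟩ := h.range_eq.superset hP
  rw [h.chart_apply]

/-- A global parametrization as a bijection from `E` onto the SPD manifold. -/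
def equivSPD (h : IsGlobalParametrization Ψ) : E ≃ SPD n where
  toFun x := ⟨Ψ x, h.range_eq.subset (mem_range_self x)⟩
  invFun P := h.chart P.toSym
  left_inv := h.chart_apply
  right_inv P := SPD.toSym_injective (h.apply_chart P.2)

lemma toSym_equivSPD (h : IsGlobalParametrization Ψ) (x : E) : (h.equivSPD x).toSym = Ψ x := rfl

lemma apply_equivSPD_symm (h : IsGlobalParametrization Ψ) (P : SPD n) :
    Ψ (h.equivSPD.symm P) = P.toSym := by
  rw [← h.toSym_equivSPD, h.equivSPD.apply_symm_apply]

lemma hasDerivAt_fderiv_chart (h : IsGlobalParametrization Ψ) {x : E}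
    {c : ℝ → symSubmodule n} {c' : symSubmodule n} {t : ℝ} (hc : HasDerivAt c c' t)
    (hct : c t = Ψ x) :
    HasDerivAt (fun s => fderiv ℝ h.chart (c s)) (fderiv ℝ (fderiv ℝ h.chart) (Ψ x) c') t := by
  have hfderiv : DifferentiableAt ℝ (fderiv ℝ h.chart) (Ψ x) :=
    ((h.contDiffAt_chart x).fderiv_right (m := 1) le_rfl).differentiableAt one_ne_zero
  exact HasFDerivAt.comp_hasDerivAt_of_eq (l := fderiv ℝ h.chart) t hfderiv.hasFDerivAt hc hct.symm

lemma hasDerivAt_fderiv_chart_apply (h : IsGlobalParametrization Ψ) {x : E}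
    {c V : ℝ → symSubmodule n} {c' V' : symSubmodule n} {t : ℝ} (hc : HasDerivAt c c' t)
    (hct : c t = Ψ x) (hV : HasDerivAt V V' t) :
    HasDerivAt (fun s => fderiv ℝ h.chart (c s) (V s))
      (fderiv ℝ (fderiv ℝ h.chart) (Ψ x) c' (V t) + fderiv ℝ h.chart (Ψ x) V') t :=
  hct ▸ (h.hasDerivAt_fderiv_chart hc hct).clm_apply hV

lemma hasDerivAt_curve_equivSPD (h : IsGlobalParametrization Ψ) {x : ℝ → E} {x' : E} {t : ℝ}
    (hx : HasDerivAt x x' t) :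
    HasDerivAt (curve fun s => h.equivSPD (x s)) (fderiv ℝ Ψ (x t) x') t :=
  hasDerivAt_coe_symSubmodule ((h.hasStrictFDerivAt (x t)).hasFDerivAt.comp_hasDerivAt t hx)

end IsGlobalParametrization

/-! ### Flat metrics -/

/-- `Ψ` is a global parametrization of the SPD manifold by a vector space `E` in which the metric
`g` is the constant symmetric nondegenerate form `B`; that is, an isometry of `(E, B)` onto the SPD
manifold with the metric `g`. -/
structure IsFlatParametrization (g : RMetric n) (B : E →L[ℝ] E →L[ℝ] ℝ)
    (Ψ : E → symSubmodule n) : Prop extends IsGlobalParametrization Ψ where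
  symm (y z : E) : B y z = B z y
  eq_zero_of_forall (y : E) : (∀ z, B y z = 0) → y = 0
  metric_fderiv (x y z : E) : g (Ψ x) (fderiv ℝ Ψ x y) (fderiv ℝ Ψ x z) = B y z

namespace IsFlatParametrization

variable {g : RMetric n} {B : E →L[ℝ] E →L[ℝ] ℝ} {Ψ : E → symSubmodule n} [CompleteSpace E]

lemma metric_eq (h : IsFlatParametrization g B Ψ) (x : E) (W V : symSubmodule n) :
    g (Ψ x) W V = B (fderiv ℝ h.chart (Ψ x) W) (fderiv ℝ h.chart (Ψ x) V) := by
  obtain ⟨y, rfl⟩ := (h.fderivEquiv x).surjective W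
  obtain ⟨z, rfl⟩ := (h.fderivEquiv x).surjective V
  rw [h.fderiv_chart]
  simp only [ContinuousLinearEquiv.coe_coe, ContinuousLinearEquiv.symm_apply_apply]
  exact h.metric_fderiv x y z

lemma dMetric_eq (h : IsFlatParametrization g B Ψ) (x : E) (Z W V : symSubmodule n) :
    dMetric g (Ψ x) Z W V =
      B (fderiv ℝ (fderiv ℝ h.chart) (Ψ x) Z W) (fderiv ℝ h.chart (Ψ x) V) +
        B (fderiv ℝ h.chart (Ψ x) W) (fderiv ℝ (fderiv ℝ h.chart) (Ψ x) Z V) := by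
  set c : ℝ → symSubmodule n := fun t => Ψ x + t • Z with hc_def
  have hc : HasDerivAt c Z 0 := by
    simpa [hc_def] using ((hasDerivAt_id (0 : ℝ)).smul_const Z).const_add (Ψ x)
  have hc0 : c 0 = Ψ x := by simp [hc_def]
  have heq : (fun t : ℝ => g (Ψ x + t • Z : Mat n) W V) =ᶠ[𝓝 0]
      fun t => B (fderiv ℝ h.chart (c t) W) (fderiv ℝ h.chart (c t) V) := by
    have hrange : range Ψ ∈ 𝓝 (c 0) :=
      h.isOpenEmbedding.isOpen_range.mem_nhds (hc0 ▸ mem_range_self x)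
    filter_upwards [hc.continuousAt hrange] with t ht
    obtain ⟨y, hy⟩ := ht
    rw [← hy, ← h.metric_eq, hy, hc_def, Submodule.coe_add, Submodule.coe_smul]
  have hD := h.hasDerivAt_fderiv_chart hc hc0
  have hDW := hD.clm_apply (hasDerivAt_const 0 W)
  have hDV := hD.clm_apply (hasDerivAt_const 0 V)
  have hB := (B.hasFDerivAt.comp_hasDerivAt (0 : ℝ) hDW).clm_apply hDV
  rw [dMetric, heq.deriv_eq]
  simpa [hc0] using hB.deriv

lemma christoffel_eq (h : IsFlatParametrization g B Ψ) (x : E) (W V Z : symSubmodule n) :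
    christoffel g (Ψ x) W V Z =
      B (fderiv ℝ (fderiv ℝ h.chart) (Ψ x) W V) (fderiv ℝ h.chart (Ψ x) Z) := by
  have hsymm : IsSymmSndFDerivAt ℝ h.chart (Ψ x) :=
    (h.contDiffAt_chart x).isSymmSndFDerivAt (by simp)
  rw [christoffel, h.dMetric_eq, h.dMetric_eq, h.dMetric_eq, hsymm V W, hsymm Z W, hsymm Z V,
    h.symm (fderiv ℝ h.chart (Ψ x) V), h.symm (fderiv ℝ h.chart (Ψ x) W)]
  ring

lemma forall_covariantDeriv_eq_zero_iff (h : IsFlatParametrization g B Ψ) {x : E}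
    {c V : ℝ → symSubmodule n} {c' V' : symSubmodule n} {t : ℝ} (hc : HasDerivAt c c' t)
    (hct : c t = Ψ x) (hV : HasDerivAt V V' t) :
    (∀ Z : symSubmodule n, g (Ψ x) V' Z + christoffel g (Ψ x) c' (V t) Z = 0) ↔
      HasDerivAt (fun s => fderiv ℝ h.chart (c s) (V s)) 0 t := by
  have hderiv := h.hasDerivAt_fderiv_chart_apply hc hct hV
  set y' := fderiv ℝ (fderiv ℝ h.chart) (Ψ x) c' (V t) + fderiv ℝ h.chart (Ψ x) V' with hy'
  have hB (Z : symSubmodule n) : g (Ψ x) V' Z + christoffel g (Ψ x) c' (V t) Z =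
      B y' (fderiv ℝ h.chart (Ψ x) Z) := by
    rw [h.metric_eq, h.christoffel_eq, hy', map_add, _root_.add_apply, add_comm]
  have hy'_eq : y' = 0 ↔ ∀ Z, B y' (fderiv ℝ h.chart (Ψ x) Z) = 0 := by
    refine ⟨fun h0 Z => by simp [h0], fun h0 => h.eq_zero_of_forall y' fun z => ?_⟩
    simpa [h.fderiv_chart] using h0 (h.fderivEquiv x z)
  simp_rw [hB, ← hy'_eq]
  exact ⟨fun h0 => h0 ▸ hderiv, hderiv.unique⟩

lemma isParallelAlong_coe_iff (h : IsFlatParametrization g B Ψ) {γ : ℝ → SPD n}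
    {V : ℝ → symSubmodule n} :
    IsParallelAlong g γ (fun t => V t) ↔ Differentiable ℝ (fun t => (γ t).toSym) ∧
      Differentiable ℝ V ∧ ∀ t, HasDerivAt (fun s => fderiv ℝ h.chart (γ s).toSym (V s)) 0 t := by
  change (Differentiable ℝ (fun t => ((γ t).toSym : Mat n)) ∧ _) ↔ _
  rw [differentiable_coe_symSubmodule, differentiable_coe_symSubmodule]
  refine and_congr_right fun hγ => and_congr_right fun hV => ?_
  refine (and_iff_right fun t => (V t).2).trans (forall_congr' fun t => ?_)
  rw [← h.forall_covariantDeriv_eq_zero_iff (hγ t).hasDerivAt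
    (h.apply_equivSPD_symm (γ t)).symm (hV t).hasDerivAt, h.apply_equivSPD_symm,
    (hasDerivAt_coe_symSubmodule (hV t).hasDerivAt).deriv,
    show deriv (curve γ) t = _ from (hasDerivAt_coe_symSubmodule (hγ t).hasDerivAt).deriv]
  exact ⟨fun hZ Z => hZ Z Z.2, fun hZ Z hZ_symm => hZ ⟨Z, hZ_symm⟩⟩

lemma isParallelAlong_iff (h : IsFlatParametrization g B Ψ) {γ : ℝ → SPD n} {V : ℝ → Mat n} :
    IsParallelAlong g γ V ↔ ∃ (x : ℝ → E) (y : E), Differentiable ℝ x ∧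
      (∀ t, γ t = h.equivSPD (x t)) ∧ ∀ t, V t = fderiv ℝ Ψ (x t) y := by
  constructor
  · intro hparallel
    lift V to ℝ → symSubmodule n using hparallel.2.2.1
    obtain ⟨hγ, -, hconst⟩ := h.isParallelAlong_coe_iff.mp hparallel
    have hΨ (t : ℝ) : (γ t).toSym = Ψ (h.equivSPD.symm (γ t)) := (h.apply_equivSPD_symm (γ t)).symm
    refine ⟨fun t => h.equivSPD.symm (γ t), fderiv ℝ h.chart (γ 0).toSym (V 0), fun t => ?_,
      fun t => (h.equivSPD.apply_symm_apply (γ t)).symm, fun t => ?_⟩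
    · exact ((hΨ t ▸ (h.hasFDerivAt_chart _).differentiableAt).comp t (hγ t) :)
    · rw [is_const_of_deriv_eq_zero (fun s => (hconst s).differentiableAt)
        (fun s => (hconst s).deriv) 0 t, hΨ, h.fderiv_chart]
      exact congrArg Subtype.val ((h.fderivEquiv _).apply_symm_apply (V t)).symm
  · rintro ⟨x, y, hx, hγ, hV⟩
    obtain rfl : γ = fun t => h.equivSPD (x t) := funext hγ
    obtain rfl : V = fun t => (fderiv ℝ Ψ (x t) y : Mat n) := funext hV
    refine h.isParallelAlong_coe_iff.mpr ⟨(h.contDiff.differentiable two_ne_zero).comp hx, ?_, ?_⟩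
    · exact (((h.contDiff.fderiv_right le_rfl).differentiable one_ne_zero).comp hx).clm_apply
        (differentiable_const y)
    · refine fun t => (hasDerivAt_const t y).congr_of_eventuallyEq (.of_forall fun s => ?_)
      change fderiv ℝ h.chart (Ψ (x s)) (fderiv ℝ Ψ (x s) y) = y
      rw [h.fderiv_chart]
      exact (h.fderivEquiv (x s)).symm_apply_apply y

lemma isGeodesic_iff (h : IsFlatParametrization g B Ψ) {γ : ℝ → SPD n} :
    IsGeodesic g γ ↔ ∃ x v : E, γ = fun t => h.equivSPD (x + t • v) := by
  rw [IsGeodesic, h.isParallelAlong_iff]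
  constructor
  · rintro ⟨x, v, hx, hγ, hvel⟩
    obtain rfl : γ = fun t => h.equivSPD (x t) := funext hγ
    have hderiv (t : ℝ) : deriv x t = v := (h.bijective_fderiv (x t)).1 <| Subtype.ext <|
      (h.hasDerivAt_curve_equivSPD (hx t).hasDerivAt).deriv.symm.trans (hvel t)
    refine ⟨x 0, v, funext fun t => congrArg h.equivSPD ?_⟩
    exact eq_add_smul_of_hasDerivAt (fun s => hderiv s ▸ (hx s).hasDerivAt) t
  · rintro ⟨x, v, rfl⟩
    have hline := hasDerivAt_add_smul x v
    exact ⟨_, v, fun t => (hline t).differentiableAt, fun _ => rfl,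
      fun t => (h.hasDerivAt_curve_equivSPD (hline t)).deriv⟩

lemma riemExp_equivSPD (h : IsFlatParametrization g B Ψ) (x v : E) :
    riemExp g (h.equivSPD x) (fderiv ℝ Ψ x v) = h.equivSPD (x + v) := by
  have hvelocity (y w : E) :
      deriv (curve fun t => h.equivSPD (y + t • w)) 0 = fderiv ℝ Ψ y w := by
    simpa using (h.hasDerivAt_curve_equivSPD (hasDerivAt_add_smul y w 0)).deriv
  refine epsilon_eq fun R => ⟨?_, ?_⟩
  · rintro ⟨γ, hγ, hγ0, hγ', rfl⟩
    obtain ⟨y, w, rfl⟩ := h.isGeodesic_iff.mp hγ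
    obtain rfl : y = x := h.equivSPD.injective (by simpa using hγ0)
    obtain rfl := h.fderiv_coe_injective y ((hvelocity y w).symm.trans hγ')
    simp only [one_smul]
  · rintro rfl
    exact ⟨_, h.isGeodesic_iff.mpr ⟨x, v, rfl⟩, by simp, hvelocity x v, by simp⟩

lemma riemLog_equivSPD (h : IsFlatParametrization g B Ψ) (x y : E) :
    riemLog g (h.equivSPD x) (h.equivSPD y) = fderiv ℝ Ψ x (y - x) := by
  refine epsilon_eq fun W => ⟨?_, ?_⟩
  · rintro ⟨hW, hexp⟩
    obtain ⟨v, hv⟩ := (h.bijective_fderiv x).2 ⟨W, hW⟩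
    obtain rfl : (fderiv ℝ Ψ x v : Mat n) = W := congrArg Subtype.val hv
    rw [h.riemExp_equivSPD] at hexp
    rw [← h.equivSPD.injective hexp, add_sub_cancel_left]
  · rintro rfl
    exact ⟨(fderiv ℝ Ψ x (y - x)).2, by rw [h.riemExp_equivSPD, add_sub_cancel]⟩

lemma transport_equivSPD (h : IsFlatParametrization g B Ψ) (x y v : E) :
    transport g (h.equivSPD x) (h.equivSPD y) (fderiv ℝ Ψ x v) = fderiv ℝ Ψ y v := by
  refine epsilon_eq fun W => ⟨?_, ?_⟩
  · rintro ⟨γ, V, -, hγ0, hγ1, hV, hV0, rfl⟩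
    obtain ⟨c, w, -, hγ, hV⟩ := h.isParallelAlong_iff.mp hV
    obtain rfl : c 0 = x := h.equivSPD.injective (hγ0 ▸ (hγ 0).symm)
    obtain rfl : c 1 = y := h.equivSPD.injective (hγ1 ▸ (hγ 1).symm)
    rw [hV, h.fderiv_coe_injective (c 0) ((hV 0).symm.trans hV0)]
  · rintro rfl
    have hline := hasDerivAt_add_smul x (y - x)
    exact ⟨fun t => h.equivSPD (x + t • (y - x)), fun t => fderiv ℝ Ψ (x + t • (y - x)) v,
      h.isGeodesic_iff.mpr ⟨x, y - x, rfl⟩, by simp, by simp,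
      h.isParallelAlong_iff.mpr
        ⟨_, v, fun t => (hline t).differentiableAt, fun _ => rfl, fun _ => rfl⟩,
      by simp, by simp⟩

lemma gyroAdd_equivSPD (h : IsFlatParametrization g B Ψ) (x y : E) :
    gyroAdd g (h.equivSPD x) (h.equivSPD y) =
      h.equivSPD (x + (y - h.equivSPD.symm (SPD.id n))) := by
  obtain ⟨o, ho⟩ := h.equivSPD.surjective (SPD.id n)
  rw [gyroAdd, ← ho, h.riemLog_equivSPD, h.transport_equivSPD, h.riemExp_equivSPD,
    h.equivSPD.symm_apply_apply]

lemma spdNorm_equivSPD (h : IsFlatParametrization g B Ψ) (x : E) :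
    spdNorm g (h.equivSPD x) = √(B (x - h.equivSPD.symm (SPD.id n))
      (x - h.equivSPD.symm (SPD.id n))) := by
  obtain ⟨o, ho⟩ := h.equivSPD.surjective (SPD.id n)
  rw [spdNorm, spdInner, ← ho, h.riemLog_equivSPD, h.equivSPD.symm_apply_apply]
  exact congrArg Real.sqrt (h.metric_fderiv o _ _)

lemma isAutomorphicInverse (h : IsFlatParametrization g B Ψ) :
    IsAutomorphicInverse g fun P =>
      h.equivSPD (2 • h.equivSPD.symm (SPD.id n) - h.equivSPD.symm P) := by
  obtain ⟨o, ho⟩ : ∃ o, h.equivSPD.symm (SPD.id n) = o := ⟨_, rfl⟩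
  refine ⟨fun R P => ?_, fun P Q => ?_, fun P => ?_⟩
  · obtain ⟨x, rfl⟩ := h.equivSPD.surjective R
    obtain ⟨y, rfl⟩ := h.equivSPD.surjective P
    rw [h.gyroAdd_equivSPD, h.equivSPD.apply_eq_iff_eq, ← h.equivSPD.eq_symm_apply,
      h.equivSPD.symm_apply_apply, ho]
    grind
  · obtain ⟨x, rfl⟩ := h.equivSPD.surjective P
    obtain ⟨y, rfl⟩ := h.equivSPD.surjective Q
    simp only [h.gyroAdd_equivSPD, h.equivSPD.symm_apply_apply, ho]
    congr 1
    module
  · obtain ⟨x, rfl⟩ := h.equivSPD.surjective P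
    have hneg : 2 • o - x - o = -(x - o) := by module
    simp only [h.spdNorm_equivSPD, h.equivSPD.symm_apply_apply, ho, hneg, map_neg,
      _root_.neg_apply, neg_neg]

end IsFlatParametrization

/-! ### The Frobenius form -/

lemma frob_comm (A B : Mat n) : frob A B = frob B A := by
  rw [frob, ← trace_transpose, transpose_mul, transpose_transpose, frob]

lemma frob_self_eq_zero_iff {A : Mat n} : frob A A = 0 ↔ A = 0 := by
  rw [frob, ← conjTranspose_eq_transpose_of_trivial, trace_conjTranspose_mul_self_eq_zero_iff]

/-- The Frobenius inner product on a space `F` of matrices, as a continuous bilinear form. -/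
def frobForm (F : Submodule ℝ (Mat n)) : F →L[ℝ] F →L[ℝ] ℝ :=
  LinearMap.toContinuousBilinearMap <| LinearMap.mk₂ ℝ (fun A B : F => frob A.1 B.1)
    (fun A A' B => by simp [frob, add_mul]) (fun c A B => by simp [frob])
    (fun A B B' => by simp [frob, mul_add]) (fun c A B => by simp [frob])

variable {F : Submodule ℝ (Mat n)}

lemma frobForm_apply (A B : F) : frobForm F A B = frob A.1 B.1 := rfl

lemma frobForm_comm (A B : F) : frobForm F A B = frobForm F B A := frob_comm A.1 B.1

lemma eq_zero_of_forall_frobForm_eq_zero (A : F) (hA : ∀ B, frobForm F A B = 0) : A = 0 :=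
  Subtype.ext <| frob_self_eq_zero_iff.mp (hA A)

/-! ### The Log-Euclidean metric -/

lemma fderiv_exp_injective_of_isSelfAdjoint {A : Type*} [NormedRing A] [StarRing A]
    [NormedAlgebra ℝ A] [CompleteSpace A] [ContinuousFunctionalCalculus ℝ A IsSelfAdjoint] {a : A}
    (ha : IsSelfAdjoint a) : Function.Injective (fderiv ℝ (exp : A → A) a) := by
  let := NormedAlgebra.restrictScalars ℚ ℝ A
  refine (injective_iff_map_eq_zero _).mpr fun h hh => ?_
  have hline := hasDerivAt_add_smul a h 0
  have hexp : HasDerivAt (fun t : ℝ => exp (a + t • h)) 0 0 :=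
    hh ▸ (exp_analytic (𝕂 := ℝ) a).differentiableAt.hasFDerivAt.comp_hasDerivAt_of_eq 0 hline
      (by simp)
  have hcomm_exp : Commute (exp a) h := by
    have hleft := hline.fun_mul hexp
    simp_rw [fun t : ℝ => ((Commute.refl (a + t • h)).exp_right).eq] at hleft
    exact (by simpa using (hexp.fun_mul hline).unique hleft : exp a * h = h * exp a)
  have hcomm : Commute a h := by
    have hcomm_log : Commute (CFC.log (exp a)) h := hcomm_exp.cfc_real Real.log
    rwa [CFC.log_exp a] at hcomm_log
  have hprod : HasDerivAt (fun t : ℝ => exp a * exp (t • h)) (exp a * h) 0 := by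
    simpa using (hasDerivAt_exp_smul_const h (0 : ℝ)).const_mul (exp a)
  simp_rw [fun t : ℝ => NormedSpace.exp_add_of_commute (hcomm.smul_right t)] at hexp
  exact (isUnit_exp a).mul_right_eq_zero.mp (hprod.unique hexp)

lemma isSelfAdjoint_of_isSymm {X : Mat n} (hX : X.IsSymm) : IsSelfAdjoint X :=
  isHermitian_iff_isSymm.mpr hX

lemma matLog_exp {X : Mat n} (hX : X.IsSymm) : matLog (exp X) = X :=
  CFC.log_exp X (isSelfAdjoint_of_isSymm hX)

lemma exp_matLog {P : Mat n} (hP : P.PosDef) : exp (matLog P) = P :=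
  CFC.exp_log (A := Mat n) P hP.isStrictlyPositive

lemma isSymm_matLog (P : Mat n) : (matLog P).IsSymm :=
  isHermitian_iff_isSymm.mp (cfc_predicate Real.log P)

lemma posDef_exp {X : Mat n} (hX : X.IsSymm) : (exp X).PosDef :=
  IsStrictlyPositive.posDef
    ((Matrix.isUnit_exp X).isStrictlyPositive (isSelfAdjoint_of_isSymm hX).exp_nonneg)

/-- The matrix exponential on symmetric matrices. -/
def symExp (n : ℕ) (X : symSubmodule n) : symSubmodule n := symPart n (exp (X : Mat n))

lemma coe_symExp (X : symSubmodule n) : (symExp n X : Mat n) = exp (X : Mat n) :=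
  coe_symPart X.2.exp

lemma contDiff_symExp : ContDiff ℝ 2 (symExp n) := by
  have hexp : ContDiff ℝ 2 (exp : Mat n → Mat n) :=
    contDiff_iff_contDiffAt.mpr fun X => (exp_analytic (𝕂 := ℝ) X).contDiffAt
  exact (symPart n).contDiff.comp (hexp.comp (symSubmodule n).subtypeL.contDiff)

lemma coe_fderiv_symExp (X Y : symSubmodule n) :
    (fderiv ℝ (symExp n) X Y : Mat n) = fderiv ℝ (exp : Mat n → Mat n) X Y := by
  refine coe_fderiv_eq_of_hasDerivAt (contDiff_symExp.differentiable two_ne_zero X) ?_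
  simp only [coe_symExp]
  exact (exp_analytic (𝕂 := ℝ) (X : Mat n)).differentiableAt.hasFDerivAt.comp_hasDerivAt_of_eq 0
    (hasDerivAt_coe_symSubmodule (hasDerivAt_add_smul X Y 0)) (by simp)

lemma isGlobalParametrization_symExp : IsGlobalParametrization (symExp n) where
  contDiff := contDiff_symExp
  injective X Y hXY := Subtype.ext <| by
    rw [← matLog_exp X.2, ← matLog_exp Y.2, ← coe_symExp, ← coe_symExp, hXY]
  range_eq := by
    ext P
    refine ⟨?_, fun hP => ⟨⟨matLog P.1, isSymm_matLog P.1⟩, Subtype.ext ?_⟩⟩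
    · rintro ⟨X, rfl⟩
      exact (coe_symExp X ▸ posDef_exp X.2 : (symExp n X : Mat n).PosDef)
    · exact (coe_symExp _).trans (exp_matLog hP)
  bijective_fderiv X := by
    have hinj : Function.Injective (fderiv ℝ (symExp n) X) := fun Y Z hYZ => Subtype.ext <|
      fderiv_exp_injective_of_isSelfAdjoint (isSelfAdjoint_of_isSymm X.2) <| by
        rw [← coe_fderiv_symExp, ← coe_fderiv_symExp, hYZ]
    exact ⟨hinj, LinearMap.injective_iff_surjective.mp hinj⟩

lemma dLog_fderiv_symExp (X Y : symSubmodule n) :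
    dLog (symExp n X : Mat n) (fderiv ℝ (symExp n) X Y) = Y := by
  have h := isGlobalParametrization_symExp (n := n)
  set W := fderiv ℝ (symExp n) X Y
  have hline := hasDerivAt_add_smul (symExp n X) W 0
  have hchart : HasDerivAt (fun t : ℝ => h.chart (symExp n X + t • W)) Y 0 := by
    have := (h.hasFDerivAt_chart X).comp_hasDerivAt_of_eq 0 hline (by simp)
    rwa [ContinuousLinearEquiv.coe_coe, show (h.fderivEquiv X).symm W = Y from
      (h.fderivEquiv X).symm_apply_apply Y] at this
  refine ((hasDerivAt_coe_symSubmodule hchart).congr_of_eventuallyEq ?_).deriv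
  have hrange : range (symExp n) ∈ 𝓝 (symExp n X + (0 : ℝ) • W) :=
    h.isOpenEmbedding.isOpen_range.mem_nhds (by simp)
  filter_upwards [hline.continuousAt hrange] with t ht
  obtain ⟨Z, hZ : symExp n Z = symExp n X + t • W⟩ := ht
  rw [← hZ, h.chart_apply, ← Submodule.coe_smul, ← Submodule.coe_add, ← hZ, coe_symExp,
    matLog_exp Z.2]

lemma isFlatParametrization_symExp :
    IsFlatParametrization (metricLE n) (frobForm (symSubmodule n)) (symExp n) where
  toIsGlobalParametrization := isGlobalParametrization_symExp
  symm := frobForm_comm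
  eq_zero_of_forall := eq_zero_of_forall_frobForm_eq_zero
  metric_fderiv X Y Z := by
    rw [metricLE, dLog_fderiv_symExp, dLog_fderiv_symExp, frobForm_apply]

/-! ### Lower triangular matrices -/

section LowerTriangular

variable {m R : Type*} [Fintype m] [LinearOrder m] [CommRing R]

lemma isLowerTriangular_inv {L : Matrix m m R} (hL : L.IsLowerTriangular) :
    L⁻¹.IsLowerTriangular := by
  by_cases hdet : IsUnit L.det
  · have := invertibleOfIsUnitDet L hdet
    exact blockTriangular_inv_of_blockTriangular hL
  · rw [nonsing_inv_apply_not_isUnit L hdet]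
    exact blockTriangular_zero

lemma mul_apply_self_of_isLowerTriangular {L M : Matrix m m R} (hL : L.IsLowerTriangular)
    (hM : M.IsLowerTriangular) (i : m) : (L * M) i i = L i i * M i i := by
  rw [mul_apply]
  refine Finset.sum_eq_single i (fun j _ hji => ?_) (by simp)
  rcases hji.lt_or_gt with hlt | hgt
  · rw [hM hlt, mul_zero]
  · rw [hL hgt, zero_mul]

lemma isUnit_apply_self_of_isLowerTriangular {L : Matrix m m R} (hL : L.IsLowerTriangular)
    (hdet : IsUnit L.det) (i : m) : IsUnit (L i i) := by
  rw [det_of_isLowerTriangular L hL] at hdet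
  exact IsUnit.prod_iff.mp hdet i (Finset.mem_univ i)

end LowerTriangular

lemma isUnit_det_of_isLowerTriangular {L : Mat n} (hL : L.IsLowerTriangular)
    (hpos : ∀ i, 0 < L i i) : IsUnit L.det := by
  rw [det_of_isLowerTriangular L hL]
  exact (Finset.prod_pos fun i _ => hpos i).ne'.isUnit

lemma eq_one_of_mul_transpose_eq_one {L : Mat n} (hL : L.IsLowerTriangular)
    (hpos : ∀ i, 0 < L i i) (hL_mul : L * Lᵀ = 1) : L = 1 := by
  have hLT : Lᵀ.IsLowerTriangular := inv_eq_right_inv hL_mul ▸ isLowerTriangular_inv hL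
  ext i j
  rcases lt_trichotomy i j with hij | rfl | hij
  · rw [hL hij, one_apply_ne hij.ne]
  · have hsq := mul_apply_self_of_isLowerTriangular hL hLT i
    rw [hL_mul, transpose_apply, one_apply_eq] at hsq
    rw [one_apply_eq]
    nlinarith [hpos i]
  · rw [← transpose_apply L, hLT hij, one_apply_ne hij.ne']

/-! ### The Cholesky factorization -/

lemma IsCholesky.isLowerTriangular {P L : Mat n} (hL : IsCholesky P L) : L.IsLowerTriangular :=
  hL.1

lemma IsCholesky.isUnit_det {P L : Mat n} (hL : IsCholesky P L) : IsUnit L.det :=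
  isUnit_det_of_isLowerTriangular hL.isLowerTriangular hL.2.1

lemma IsCholesky.unique {P L M : Mat n} (hL : IsCholesky P L) (hM : IsCholesky P M) : L = M := by
  have hMA : M * (M⁻¹ * L) = L := mul_nonsing_inv_cancel_left M L hM.isUnit_det
  have hA : (M⁻¹ * L).IsLowerTriangular :=
    (isLowerTriangular_inv hM.isLowerTriangular).mul hL.isLowerTriangular
  have hA_pos (i : Fin n) : 0 < (M⁻¹ * L) i i := by
    have hLi := hL.2.1 i
    rw [← hMA, mul_apply_self_of_isLowerTriangular hM.isLowerTriangular hA] at hLi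
    exact (pos_iff_pos_of_mul_pos hLi).mp (hM.2.1 i)
  have hA_mul : M⁻¹ * L * (M⁻¹ * L)ᵀ = 1 := by
    calc M⁻¹ * L * (M⁻¹ * L)ᵀ = M⁻¹ * (L * Lᵀ) * (M⁻¹)ᵀ := by
          simp only [transpose_mul, Matrix.mul_assoc]
      _ = (M⁻¹ * M) * (M⁻¹ * M)ᵀ := by
          rw [hL.2.2, ← hM.2.2]
          simp only [transpose_mul, Matrix.mul_assoc]
      _ = 1 := by rw [nonsing_inv_mul M hM.isUnit_det, transpose_one, Matrix.one_mul]
  rw [← hMA, eq_one_of_mul_transpose_eq_one hA hA_pos hA_mul, Matrix.mul_one]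

lemma exists_isCholesky_mul_transpose {M : Mat n} (hM : M.IsLowerTriangular)
    (hdet : IsUnit M.det) : ∃ L, IsCholesky (M * Mᵀ) L := by
  have hne (i : Fin n) : M i i ≠ 0 := (isUnit_apply_self_of_isLowerTriangular hM hdet i).ne_zero
  set S : Mat n := diagonal fun i => (SignType.sign (M i i) : ℝ) with hS
  have hSS : S * Sᵀ = 1 := by
    rw [hS, diagonal_transpose, diagonal_mul_diagonal, ← diagonal_one]
    congr! with i
    rcases (hne i).lt_or_gt with hlt | hgt
    · simp [hlt]
    · simp [hgt]
  refine ⟨M * S, hM.mul (blockTriangular_diagonal _), fun i => ?_, ?_⟩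
  · rw [hS, mul_diagonal, self_mul_sign]
    exact abs_pos.mpr (hne i)
  · rw [transpose_mul, Matrix.mul_assoc, ← Matrix.mul_assoc S, hSS, Matrix.one_mul]

lemma exists_isCholesky {P : Mat n} (hP : P.PosDef) : ∃ L, IsCholesky P L := by
  have hdiag : (LDL.diag hP).PosDef := by
    rw [LDL.diag_eq_lowerInv_conj]
    exact (IsUnit.posDef_star_right_conjugate_iff (isUnit_of_invertible _)).mpr hP
  have hpos (i : Fin n) : 0 < LDL.diagEntries hP i := posDef_diagonal_iff.mp hdiag i
  set D : Mat n := diagonal fun i => √(LDL.diagEntries hP i) with hD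
  have hDD : D * Dᵀ = LDL.diag hP := by
    rw [hD, diagonal_transpose, diagonal_mul_diagonal, LDL.diag]
    simp only [Real.mul_self_sqrt (hpos _).le]
  have hlower : (LDL.lower hP).IsLowerTriangular :=
    isLowerTriangular_inv fun _ _ hij => LDL.lowerInv_triangular hP hij
  have hP_eq : (LDL.lower hP * D) * (LDL.lower hP * D)ᵀ = P := by
    rw [transpose_mul, Matrix.mul_assoc, ← Matrix.mul_assoc D, hDD, ← Matrix.mul_assoc,
      ← conjTranspose_eq_transpose_of_trivial, LDL.lower_conj_diag]
  refine hP_eq ▸ exists_isCholesky_mul_transpose (hlower.mul (blockTriangular_diagonal _)) ?_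
  refine (isUnit_iff_isUnit_det _).mp (isUnit_of_mul_isUnit_left (y := (LDL.lower hP * D)ᵀ) ?_)
  exact hP_eq.symm ▸ hP.isUnit

lemma chol_eq {P L : Mat n} (hL : IsCholesky P L) : chol P = L :=
  epsilon_eq fun _ => ⟨fun hM => hM.unique hL, fun hM => hM ▸ hL⟩

/-! ### The Log-Cholesky metric -/

/-- The space of lower triangular matrices. The Log-Cholesky metric is flat in the parametrization
of the SPD manifold by this space that sends `T` to `L * Lᵀ`, where `L` is `lowerExp T`. -/
def lowerSubmodule (n : ℕ) : Submodule ℝ (Mat n) where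
  carrier := {A | A.IsLowerTriangular}
  add_mem' := BlockTriangular.add
  zero_mem' := blockTriangular_zero
  smul_mem' c A hA := fun i j hij => by rw [Matrix.smul_apply, hA hij, smul_zero]

instance : CompleteSpace (lowerSubmodule n) := FiniteDimensional.complete ℝ _

lemma strictLower_apply (A : Mat n) (i j : Fin n) :
    strictLower A i j = if j < i then A i j else 0 := rfl

lemma diagPart_apply (A : Mat n) (i j : Fin n) : diagPart A i j = if i = j then A i i else 0 :=
  diagonal_apply ..

lemma isLowerTriangular_strictLower_add_diagonal (A : Mat n) (d : Fin n → ℝ) :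
    (strictLower A + diagonal d).IsLowerTriangular :=
  BlockTriangular.add (fun _ _ hij => if_neg (not_lt_of_gt hij)) (blockTriangular_diagonal d)

lemma strictLower_strictLower_add_diagonal (A : Mat n) (d : Fin n → ℝ) :
    strictLower (strictLower A + diagonal d) = strictLower A := by
  ext i j
  rw [strictLower_apply, Matrix.add_apply, strictLower_apply]
  split_ifs with hji
  · rw [diagonal_apply_ne d hji.ne', add_zero]
  · rfl

lemma strictLower_add_diagonal_apply_self (A : Mat n) (d : Fin n → ℝ) (i : Fin n) :
    (strictLower A + diagonal d) i i = d i := by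
  rw [Matrix.add_apply, strictLower_apply, if_neg (lt_irrefl i), zero_add, diagonal_apply_eq]

lemma diagPart_strictLower_add_diagonal (A : Mat n) (d : Fin n → ℝ) :
    diagPart (strictLower A + diagonal d) = diagonal d := by
  simp only [diagPart, strictLower_add_diagonal_apply_self]

lemma strictLower_add_diagPart {A : Mat n} (hA : A.IsLowerTriangular) :
    strictLower A + diagPart A = A := by
  ext i j
  rw [Matrix.add_apply, strictLower_apply, diagPart_apply]
  rcases lt_trichotomy i j with hij | rfl | hij
  · simp [hij.ne, hij.not_gt, hA hij]
  · simp
  · simp [hij, hij.ne']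

lemma eq_of_strictLower_eq {A B : Mat n} (hA : A.IsLowerTriangular) (hB : B.IsLowerTriangular)
    (hlower : strictLower A = strictLower B) (hdiag : diagPart A = diagPart B) : A = B := by
  rw [← strictLower_add_diagPart hA, ← strictLower_add_diagPart hB, hlower, hdiag]

lemma frob_strictLower_add_frob_diagPart {A : Mat n} (hA : A.IsLowerTriangular) (B : Mat n) :
    frob (strictLower A) (strictLower B) + frob (diagPart A) (diagPart B) = frob A B := by
  simp only [frob, trace, diag_apply, mul_apply, transpose_apply, ← Finset.sum_add_distrib]
  refine Finset.sum_congr rfl fun j _ => Finset.sum_congr rfl fun i _ => ?_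
  simp only [strictLower_apply, diagPart_apply]
  rcases lt_trichotomy i j with hij | rfl | hij
  · simp [hij.ne, hij.not_gt, hA hij]
  · simp
  · simp [hij, hij.ne']

/-- The exponential of the diagonal entries of a matrix, with its strictly lower triangular part
kept and its strictly upper triangular part discarded. It maps lower triangular matrices
bijectively onto those with positive diagonal entries. -/
def lowerExp (T : Mat n) : Mat n := strictLower T + diagonal fun i => Real.exp (T i i)

lemma isCholesky_lowerExp (T : Mat n) : IsCholesky (lowerExp T * (lowerExp T)ᵀ) (lowerExp T) := by
  refine ⟨isLowerTriangular_strictLower_add_diagonal T _, fun i => ?_, rfl⟩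
  rw [lowerExp, strictLower_add_diagonal_apply_self]
  exact Real.exp_pos _

lemma eq_of_lowerExp_eq {T T' : Mat n} (hT : T.IsLowerTriangular) (hT' : T'.IsLowerTriangular)
    (h : lowerExp T = lowerExp T') : T = T' := by
  have hlower := congrArg strictLower h
  have hdiag := congrArg diagPart h
  simp only [lowerExp, strictLower_strictLower_add_diagonal] at hlower
  simp only [lowerExp, diagPart_strictLower_add_diagonal, diagonal_eq_diagonal_iff,
    Real.exp_eq_exp] at hdiag
  exact eq_of_strictLower_eq hT hT' hlower (diagonal_eq_diagonal_iff.mpr hdiag)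

lemma lowerExp_strictLower_add_diagonal_log {L : Mat n} (hL : L.IsLowerTriangular)
    (hpos : ∀ i, 0 < L i i) :
    lowerExp (strictLower L + diagonal fun i => Real.log (L i i)) = L := by
  simp only [lowerExp, strictLower_strictLower_add_diagonal, strictLower_add_diagonal_apply_self,
    Real.exp_log (hpos _)]
  exact strictLower_add_diagPart hL

/-- The operation `strictLower` as a continuous linear map. -/
def strictLowerCLM (n : ℕ) : Mat n →L[ℝ] Mat n :=
  LinearMap.toContinuousLinearMap
    { toFun := strictLower
      map_add' A B := by ext i j; by_cases hji : j < i <;> simp [strictLower_apply, hji]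
      map_smul' c A := by ext i j; by_cases hji : j < i <;> simp [strictLower_apply, hji] }

/-- The operation `Matrix.diagonal` as a continuous linear map. -/
def diagonalCLM (n : ℕ) : (Fin n → ℝ) →L[ℝ] Mat n :=
  LinearMap.toContinuousLinearMap (diagonalLinearMap (Fin n) ℝ ℝ)

/-- The operation `Matrix.diag` as a continuous linear map. -/
def diagCLM (n : ℕ) : Mat n →L[ℝ] Fin n → ℝ :=
  LinearMap.toContinuousLinearMap (diagLinearMap (Fin n) ℝ ℝ)

/-- The operation `Matrix.transpose` as a continuous linear map. -/
def transposeCLM (n : ℕ) : Mat n →L[ℝ] Mat n :=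
  LinearMap.toContinuousLinearMap (transposeLinearEquiv (Fin n) (Fin n) ℝ ℝ).toLinearMap

lemma hasDerivAt_transpose {A : ℝ → Mat n} {A' : Mat n} {t : ℝ} (hA : HasDerivAt A A' t) :
    HasDerivAt (fun s => (A s)ᵀ) A'ᵀ t :=
  (transposeCLM n).hasFDerivAt.comp_hasDerivAt t hA

lemma contDiff_lowerExp : ContDiff ℝ 2 (lowerExp (n := n)) :=
  (strictLowerCLM n).contDiff.add <| (diagonalCLM n).contDiff.comp <|
    contDiff_pi.mpr fun i => Real.contDiff_exp.comp (contDiff_pi.mp (diagCLM n).contDiff i)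

/-- The derivative of `lowerExp` at `T` along `Y`. -/
def dLowerExp (T Y : Mat n) : Mat n :=
  strictLower Y + diagonal fun i => Real.exp (T i i) * Y i i

lemma isLowerTriangular_dLowerExp (T Y : Mat n) : (dLowerExp T Y).IsLowerTriangular :=
  isLowerTriangular_strictLower_add_diagonal Y _

lemma hasDerivAt_lowerExp (T Y : Mat n) :
    HasDerivAt (fun t : ℝ => lowerExp (T + t • Y)) (dLowerExp T Y) 0 := by
  have hline := hasDerivAt_add_smul T Y 0
  have hdiag (i : Fin n) : HasDerivAt (fun t : ℝ => Real.exp ((T + t • Y) i i))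
      (Real.exp (T i i) * Y i i) 0 := by
    simpa using (hasDerivAt_add_smul (T i i) (Y i i) 0).exp
  exact ((strictLowerCLM n).hasFDerivAt.comp_hasDerivAt 0 hline).fun_add
    ((diagonalCLM n).hasFDerivAt.comp_hasDerivAt 0 (hasDerivAt_pi.mpr hdiag))

lemma exists_dLowerExp_eq (T : Mat n) {X : Mat n} (hX : X.IsLowerTriangular) :
    ∃ Y : lowerSubmodule n, dLowerExp T Y = X := by
  refine ⟨⟨strictLower X + diagonal fun i => (Real.exp (T i i))⁻¹ * X i i,
    isLowerTriangular_strictLower_add_diagonal X _⟩, ?_⟩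
  simp only [dLowerExp, strictLower_strictLower_add_diagonal, strictLower_add_diagonal_apply_self,
    mul_inv_cancel_left₀ (Real.exp_ne_zero _)]
  exact strictLower_add_diagPart hX

lemma metricCholesky_dLowerExp (T : Mat n) {Y : Mat n} (hY : Y.IsLowerTriangular) (Z : Mat n) :
    metricCholesky (lowerExp T) (dLowerExp T Y) (dLowerExp T Z) = frob Y Z := by
  have hdiag (X : Mat n) : (diagPart (lowerExp T))⁻¹ * diagPart (dLowerExp T X) = diagPart X := by
    have hX : diagPart (dLowerExp T X) = diagPart (lowerExp T) * diagPart X := by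
      rw [dLowerExp, lowerExp, diagPart_strictLower_add_diagonal,
        diagPart_strictLower_add_diagonal, diagPart, diagonal_mul_diagonal]
    have hdet : IsUnit (diagPart (lowerExp T)).det := by
      refine isUnit_det_of_isLowerTriangular (blockTriangular_diagonal _) fun i => ?_
      rw [diagPart, diagonal_apply_eq]
      exact (isCholesky_lowerExp T).2.1 i
    rw [hX, nonsing_inv_mul_cancel_left _ _ hdet]
  rw [metricCholesky, hdiag, hdiag, dLowerExp, dLowerExp, strictLower_strictLower_add_diagonal,
    strictLower_strictLower_add_diagonal, frob_strictLower_add_frob_diagPart hY]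

lemma isLowerTriangular_lowerHalf (A : Mat n) : (lowerHalf A).IsLowerTriangular := by
  rw [lowerHalf, diagPart, ← diagonal_smul]
  exact isLowerTriangular_strictLower_add_diagonal A _

lemma lowerHalf_add_transpose_self {A : Mat n} (hA : A.IsLowerTriangular) :
    lowerHalf (A + Aᵀ) = A := by
  ext i j
  simp only [lowerHalf, Matrix.add_apply, Matrix.smul_apply, strictLower_apply, diagPart_apply,
    transpose_apply, smul_eq_mul]
  rcases lt_trichotomy i j with hij | rfl | hij
  · simp [hij.ne, hij.not_gt, hA hij]
  · simp only [lt_irrefl, if_false, if_true]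
    ring
  · simp [hij, hij.ne', hA hij]

lemma lowerHalf_add_transpose_lowerHalf {S : Mat n} (hS : S.IsSymm) :
    lowerHalf S + (lowerHalf S)ᵀ = S := by
  ext i j
  simp only [lowerHalf, Matrix.add_apply, Matrix.smul_apply, strictLower_apply, diagPart_apply,
    transpose_apply, smul_eq_mul]
  rcases lt_trichotomy i j with hij | rfl | hij
  · simp [hij, hij.ne, hij.ne', hij.not_gt, hS.apply]
  · simp only [lt_irrefl, if_false, if_true]
    ring
  · simp [hij, hij.ne, hij.ne', hij.not_gt]

lemma isLowerTriangular_dChol {L : Mat n} (hL : L.IsLowerTriangular) (W : Mat n) :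
    (dChol L W).IsLowerTriangular :=
  hL.mul (isLowerTriangular_lowerHalf _)

lemma dChol_mul_transpose_add_mul_transpose {L X : Mat n} (hL : L.IsLowerTriangular)
    (hdet : IsUnit L.det) (hX : X.IsLowerTriangular) :
    dChol L (X * Lᵀ + L * Xᵀ) = X := by
  have hconj : L⁻¹ * (X * Lᵀ + L * Xᵀ) * (L⁻¹)ᵀ = L⁻¹ * X + (L⁻¹ * X)ᵀ := by
    calc L⁻¹ * (X * Lᵀ + L * Xᵀ) * (L⁻¹)ᵀ
        = L⁻¹ * X * (L⁻¹ * L)ᵀ + (L⁻¹ * L) * (L⁻¹ * X)ᵀ := by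
          simp only [transpose_mul]
          noncomm_ring
      _ = L⁻¹ * X + (L⁻¹ * X)ᵀ := by
          rw [nonsing_inv_mul L hdet, transpose_one, Matrix.mul_one, Matrix.one_mul]
  rw [dChol, hconj, lowerHalf_add_transpose_self ((isLowerTriangular_inv hL).mul hX),
    mul_nonsing_inv_cancel_left L X hdet]

lemma dChol_mul_transpose_add_mul_transpose_dChol {L W : Mat n} (hdet : IsUnit L.det)
    (hW : W.IsSymm) : dChol L W * Lᵀ + L * (dChol L W)ᵀ = W := by
  have hsymm : (L⁻¹ * W * (L⁻¹)ᵀ).IsSymm := by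
    rw [IsSymm, transpose_mul, transpose_mul, transpose_transpose, hW.eq, Matrix.mul_assoc]
  calc dChol L W * Lᵀ + L * (dChol L W)ᵀ
      = L * (lowerHalf (L⁻¹ * W * (L⁻¹)ᵀ) + (lowerHalf (L⁻¹ * W * (L⁻¹)ᵀ))ᵀ) * Lᵀ := by
        rw [dChol, transpose_mul]
        noncomm_ring
    _ = (L * L⁻¹) * W * (L * L⁻¹)ᵀ := by
        rw [lowerHalf_add_transpose_lowerHalf hsymm, transpose_mul]
        noncomm_ring
    _ = W := by
        rw [mul_nonsing_inv L hdet, transpose_one, Matrix.one_mul, Matrix.mul_one]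

/-- The inverse log-Cholesky map `T ↦ L * Lᵀ`, where `L` is `lowerExp T`. -/
def symLowerExp (n : ℕ) (T : lowerSubmodule n) : symSubmodule n :=
  symPart n (lowerExp (T : Mat n) * (lowerExp (T : Mat n))ᵀ)

lemma coe_symLowerExp (T : lowerSubmodule n) :
    (symLowerExp n T : Mat n) = lowerExp (T : Mat n) * (lowerExp (T : Mat n))ᵀ :=
  coe_symPart (isSymm_mul_transpose_self _)

lemma chol_symLowerExp (T : lowerSubmodule n) :
    chol (symLowerExp n T : Mat n) = lowerExp (T : Mat n) := by
  rw [coe_symLowerExp]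
  exact chol_eq (isCholesky_lowerExp _)

lemma contDiff_symLowerExp : ContDiff ℝ 2 (symLowerExp n) :=
  have hlower := contDiff_lowerExp.comp (lowerSubmodule n).subtypeL.contDiff
  (symPart n).contDiff.comp (hlower.mul ((transposeCLM n).contDiff.comp hlower))

lemma coe_fderiv_symLowerExp (T Y : lowerSubmodule n) :
    (fderiv ℝ (symLowerExp n) T Y : Mat n) =
      dLowerExp (T : Mat n) Y * (lowerExp (T : Mat n))ᵀ +
        lowerExp (T : Mat n) * (dLowerExp (T : Mat n) Y)ᵀ := by
  refine coe_fderiv_eq_of_hasDerivAt (contDiff_symLowerExp.differentiable two_ne_zero T) ?_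
  have hlower := hasDerivAt_lowerExp (T : Mat n) Y
  simp only [coe_symLowerExp]
  simpa using hlower.fun_mul (hasDerivAt_transpose hlower)

lemma dChol_fderiv_symLowerExp (T Y : lowerSubmodule n) :
    dChol (lowerExp (T : Mat n)) (fderiv ℝ (symLowerExp n) T Y) = dLowerExp (T : Mat n) Y := by
  have hL := isCholesky_lowerExp (T : Mat n)
  rw [coe_fderiv_symLowerExp, dChol_mul_transpose_add_mul_transpose hL.isLowerTriangular
    hL.isUnit_det (isLowerTriangular_dLowerExp _ _)]

lemma fderiv_symLowerExp_injective (T : lowerSubmodule n) :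
    Function.Injective (fderiv ℝ (symLowerExp n) T) := by
  refine (injective_iff_map_eq_zero _).mpr fun Y hY => Subtype.ext ?_
  have hdLowerExp : dLowerExp (T : Mat n) Y = dLowerExp (T : Mat n) (0 : lowerSubmodule n) := by
    rw [← dChol_fderiv_symLowerExp, ← dChol_fderiv_symLowerExp, hY, map_zero]
  have hfrob :
      frob (Y : Mat n) Y = frob ((0 : lowerSubmodule n) : Mat n) (0 : lowerSubmodule n) := by
    rw [← metricCholesky_dLowerExp (T : Mat n) Y.2, hdLowerExp, metricCholesky_dLowerExp]
    exact (0 : lowerSubmodule n).2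
  exact frob_self_eq_zero_iff.mp (hfrob.trans (frob_self_eq_zero_iff.mpr rfl))

lemma fderiv_symLowerExp_surjective (T : lowerSubmodule n) :
    Function.Surjective (fderiv ℝ (symLowerExp n) T) := by
  intro W
  have hL := isCholesky_lowerExp (T : Mat n)
  obtain ⟨Y, hY⟩ := exists_dLowerExp_eq (T : Mat n)
    (isLowerTriangular_dChol hL.isLowerTriangular W)
  refine ⟨Y, Subtype.ext ?_⟩
  rw [coe_fderiv_symLowerExp, hY, dChol_mul_transpose_add_mul_transpose_dChol hL.isUnit_det W.2]

lemma isGlobalParametrization_symLowerExp : IsGlobalParametrization (symLowerExp n) where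
  contDiff := contDiff_symLowerExp
  injective T T' hTT' := Subtype.ext <| eq_of_lowerExp_eq T.2 T'.2 <| by
    rw [← chol_symLowerExp, ← chol_symLowerExp, hTT']
  range_eq := by
    refine Subset.antisymm ?_ fun P hP => ?_
    · rintro _ ⟨T, rfl⟩
      have hL := isUnit_iff_isUnit_det _ |>.mpr (isCholesky_lowerExp (T : Mat n)).isUnit_det
      simpa [coe_symLowerExp] using posDef_mul_mul_transpose PosDef.one hL
    · obtain ⟨L, hL⟩ := exists_isCholesky hP
      refine ⟨⟨_, isLowerTriangular_strictLower_add_diagonal L fun i => Real.log (L i i)⟩,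
        Subtype.ext ?_⟩
      rw [coe_symLowerExp, lowerExp_strictLower_add_diagonal_log hL.isLowerTriangular hL.2.1,
        hL.2.2]
  bijective_fderiv T := ⟨fderiv_symLowerExp_injective T, fderiv_symLowerExp_surjective T⟩

lemma isFlatParametrization_symLowerExp :
    IsFlatParametrization (metricLC n) (frobForm (lowerSubmodule n)) (symLowerExp n) where
  toIsGlobalParametrization := isGlobalParametrization_symLowerExp
  symm := frobForm_comm
  eq_zero_of_forall := eq_zero_of_forall_frobForm_eq_zero
  metric_fderiv T Y Z := by
    rw [metricLC, chol_symLowerExp, dChol_fderiv_symLowerExp, dChol_fderiv_symLowerExp,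
      metricCholesky_dLowerExp _ Y.2, frobForm_apply]

/-! ### The Affine-Invariant metric: parallel transport -/

lemma isSymm_mul_mul {R X : Mat n} (hR : R.IsSymm) (hX : X.IsSymm) : (R * X * R).IsSymm := by
  rw [IsSymm, transpose_mul, transpose_mul, hR.eq, hX.eq, mul_assoc]

lemma isSymm_of_hasDerivAt {A : ℝ → Mat n} {A' : Mat n} {t : ℝ} (hA : HasDerivAt A A' t)
    (hsymm : ∀ s, (A s).IsSymm) : A'.IsSymm :=
  (hasDerivAt_transpose hA).unique (hA.congr_of_eventuallyEq (.of_forall fun s => (hsymm s).eq))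

lemma isSymm_deriv_curve {γ : ℝ → SPD n} (hγ : Differentiable ℝ (curve γ)) (t : ℝ) :
    (deriv (curve γ) t).IsSymm :=
  isSymm_of_hasDerivAt (hγ t).hasDerivAt fun s => isSymm_of_posDef (γ s).2

lemma hasDerivAt_trace {A : ℝ → Mat n} {A' : Mat n} {t : ℝ} (hA : HasDerivAt A A' t) :
    HasDerivAt (fun s => (A s).trace) A'.trace t :=
  (traceLinearMap (Fin n) ℝ ℝ).toContinuousLinearMap.hasFDerivAt.comp_hasDerivAt t hA

lemma hasDerivAt_nonsing_inv {A : ℝ → Mat n} {A' : Mat n} {t : ℝ} (hA : HasDerivAt A A' t)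
    (hunit : IsUnit (A t)) : HasDerivAt (fun s => (A s)⁻¹) (-((A t)⁻¹ * A' * (A t)⁻¹)) t := by
  obtain ⟨u, hu⟩ := hunit
  have hinverse := (hasFDerivAt_ringInverse (𝕜 := ℝ) u).comp_hasDerivAt_of_eq t hA hu
  rw [← hu, ← coe_units_inv]
  simp only [nonsing_inv_eq_ringInverse]
  exact hinverse

lemma dMetric_metricAI {P : Mat n} (hP : P.PosDef) (Z W V : Mat n) :
    dMetric (metricAI n) P Z W V =
      -(P⁻¹ * Z * P⁻¹ * W * P⁻¹ * V).trace - (P⁻¹ * W * P⁻¹ * Z * P⁻¹ * V).trace := by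
  have hinv := hasDerivAt_nonsing_inv (hasDerivAt_add_smul P Z 0) (by simpa using hP.isUnit)
  refine (hasDerivAt_trace (((hinv.mul_const W).fun_mul hinv).mul_const V)).deriv.trans ?_
  simp only [zero_smul, add_zero, neg_mul, mul_neg, add_mul, trace_add, trace_neg, mul_assoc]
  ring

lemma christoffel_metricAI {P : Mat n} (hP : P.PosDef) (W V Z : Mat n) :
    christoffel (metricAI n) P W V Z =
      -metricAI n P ((1 / 2 : ℝ) • (W * P⁻¹ * V + V * P⁻¹ * W)) Z := by
  have hZWV : (P⁻¹ * Z * P⁻¹ * W * P⁻¹ * V).trace = (P⁻¹ * W * P⁻¹ * V * P⁻¹ * Z).trace := by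
    simpa only [mul_assoc] using trace_mul_comm (P⁻¹ * Z) (P⁻¹ * W * P⁻¹ * V)
  have hWZV : (P⁻¹ * W * P⁻¹ * Z * P⁻¹ * V).trace = (P⁻¹ * V * P⁻¹ * W * P⁻¹ * Z).trace := by
    simpa only [mul_assoc] using trace_mul_comm (P⁻¹ * W * P⁻¹ * Z) (P⁻¹ * V)
  rw [christoffel, dMetric_metricAI hP, dMetric_metricAI hP, dMetric_metricAI hP, hZWV, hWZV]
  simp only [metricAI, Matrix.mul_smul, Matrix.smul_mul, mul_add, add_mul, trace_add, trace_smul,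
    mul_assoc, smul_eq_mul]
  ring

lemma eq_zero_of_metricAI_self_eq_zero {P U : Mat n} (hP : P.PosDef) (hU : U.IsSymm)
    (h : metricAI n P U U = 0) : U = 0 := by
  obtain ⟨R, hR, hRself, hRR⟩ :=
    CStarAlgebra.isStrictlyPositive_iff_exists_isUnit_and_isSelfAdjoint_and_eq_mul_self.mp
      hP.inv.isStrictlyPositive
  have hRsymm : R.IsSymm := isHermitian_iff_isSymm.mp hRself
  have hfrob : frob (R * U * R) (R * U * R) = 0 := by
    rw [← h, metricAI, frob, hRR, (isSymm_mul_mul hRsymm hU).eq]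
    simpa only [mul_assoc] using trace_mul_comm (R * U * R * R * U) R
  rwa [frob_self_eq_zero_iff, hR.mul_left_eq_zero, hR.mul_right_eq_zero] at hfrob

lemma isParallelAlong_metricAI_iff {γ : ℝ → SPD n} {V : ℝ → Mat n} :
    IsParallelAlong (metricAI n) γ V ↔ Differentiable ℝ (curve γ) ∧ Differentiable ℝ V ∧
      (∀ t, (V t).IsSymm) ∧ ∀ t, deriv V t = (1 / 2 : ℝ) •
        (deriv (curve γ) t * (γ t).1⁻¹ * V t + V t * (γ t).1⁻¹ * deriv (curve γ) t) := by
  refine and_congr_right fun hγ => and_congr_right fun hV => and_congr_right fun hVsymm =>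
    forall_congr' fun t => ?_
  set N : Mat n := (1 / 2 : ℝ) •
    (deriv (curve γ) t * (γ t).1⁻¹ * V t + V t * (γ t).1⁻¹ * deriv (curve γ) t) with hN
  have hNsymm : N.IsSymm := by
    rw [IsSymm, hN, transpose_smul, transpose_add]
    simp only [transpose_mul, (isSymm_of_posDef (γ t).2.inv).eq, (isSymm_deriv_curve hγ t).eq,
      (hVsymm t).eq, mul_assoc]
    rw [add_comm]
  have hsub (Z : Mat n) : metricAI n (γ t).1 (deriv V t) Z +
      christoffel (metricAI n) (γ t).1 (deriv (curve γ) t) (V t) Z =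
        metricAI n (γ t).1 (deriv V t - N) Z := by
    rw [christoffel_metricAI (γ t).2, ← hN]
    simp only [metricAI, mul_sub, sub_mul, trace_sub]
    ring
  simp only [hsub]
  refine ⟨fun hzero => ?_, fun hVN Z _ => ?_⟩
  · have hdiff := (isSymm_of_hasDerivAt (hV t).hasDerivAt hVsymm).sub hNsymm
    exact sub_eq_zero.mp (eq_zero_of_metricAI_self_eq_zero (γ t).2 hdiff (hzero _ hdiff))
  · rw [hVN, sub_self]
    simp [metricAI]

lemma eq_of_hasDerivAt_clm {L : E →L[ℝ] E} {x y : ℝ → E} (hx : ∀ t, HasDerivAt x (L (x t)) t)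
    (hy : ∀ t, HasDerivAt y (L (y t)) t) (h₀ : x 0 = y 0) : x = y :=
  ODE_solution_unique_univ (v := fun _ => L) (s := fun _ => univ)
    (fun _ => L.lipschitz.lipschitzOnWith) (fun t => ⟨hx t, mem_univ _⟩)
    (fun t => ⟨hy t, mem_univ _⟩) h₀

/-- The congruence flow `X ↦ exp(tC/2)ᵀ X exp(tC/2)`. For the Affine-Invariant metric it describes
both the geodesics `γ` with `γ⁻¹ γ' = C` and the parallel transport along them. -/
def congrFlow (C : Mat n) (t : ℝ) (X : Mat n) : Mat n :=
  (exp (t • (1 / 2 : ℝ) • C))ᵀ * X * exp (t • (1 / 2 : ℝ) • C)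

section congrFlow

variable {C X : Mat n}

lemma congrFlow_zero (C X : Mat n) : congrFlow C 0 X = X := by
  simp [congrFlow]

lemma isSymm_congrFlow (C : Mat n) (t : ℝ) (hX : X.IsSymm) : (congrFlow C t X).IsSymm := by
  rw [IsSymm, congrFlow, transpose_mul, transpose_mul, transpose_transpose, hX.eq, mul_assoc]

lemma posDef_congrFlow (C : Mat n) (t : ℝ) (hX : X.PosDef) : (congrFlow C t X).PosDef := by
  have := posDef_mul_mul_transpose hX
    ((isUnit_transpose _).mpr (Matrix.isUnit_exp (t • (1 / 2 : ℝ) • C)))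
  rwa [transpose_transpose] at this

lemma hasDerivAt_congrFlow (C X : Mat n) (t : ℝ) :
    HasDerivAt (fun s => congrFlow C s X)
      ((1 / 2 : ℝ) • (Cᵀ * congrFlow C t X + congrFlow C t X * C)) t := by
  have hexp := hasDerivAt_exp_smul_const ((1 / 2 : ℝ) • C) t
  refine (((hasDerivAt_transpose hexp).mul_const X).fun_mul hexp).congr_deriv ?_
  simp only [congrFlow, transpose_mul, transpose_smul, Matrix.smul_mul, Matrix.mul_smul, smul_add,
    mul_assoc]

lemma eq_congrFlow_of_hasDerivAt {V : ℝ → Mat n}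
    (hV : ∀ t, HasDerivAt V ((1 / 2 : ℝ) • (Cᵀ * V t + V t * C)) t) (t : ℝ) :
    V t = congrFlow C t (V 0) :=
  congrFun (eq_of_hasDerivAt_clm
    (L := (1 / 2 : ℝ) • (ContinuousLinearMap.mul ℝ (Mat n) Cᵀ +
      (ContinuousLinearMap.mul ℝ (Mat n)).flip C))
    hV (hasDerivAt_congrFlow C (V 0)) (congrFlow_zero C (V 0)).symm) t

lemma congrFlow_mul (C X : Mat n) (t : ℝ) : congrFlow C t (X * C) = congrFlow C t X * C := by
  have hcomm : Commute C (exp (t • (1 / 2 : ℝ) • C)) :=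
    (((Commute.refl C).smul_right _).smul_right t).exp_right
  simp only [congrFlow, mul_assoc, hcomm.eq]

lemma hasDerivAt_congrFlow_of_isSymm (hX : X.IsSymm) (hXC : (X * C).IsSymm) (t : ℝ) :
    HasDerivAt (fun s => congrFlow C s X) (congrFlow C t X * C) t := by
  have hsymm : Cᵀ * congrFlow C t X = congrFlow C t X * C := by
    rw [← congrFlow_mul, ← (isSymm_congrFlow C t hXC).eq, congrFlow_mul, transpose_mul,
      (isSymm_congrFlow C t hX).eq]
  refine (hasDerivAt_congrFlow C X t).congr_deriv ?_
  rw [hsymm]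
  module

end congrFlow

lemma mul_eq_transpose_mul_of_hasDerivAt {γ : ℝ → SPD n} {C : Mat n}
    (hγ : ∀ t, HasDerivAt (curve γ) ((γ t).1 * C) t) (t : ℝ) :
    (γ t).1 * C = Cᵀ * (γ t).1 := by
  rw [← (hγ t).deriv, ← (isSymm_deriv_curve (fun s => (hγ s).differentiableAt) t).eq,
    (hγ t).deriv, transpose_mul, (isSymm_of_posDef (γ t).2).eq]

lemma isParallelAlong_metricAI_iff_eq_congrFlow {γ : ℝ → SPD n} {C : Mat n} {V : ℝ → Mat n}
    (hγ : ∀ t, HasDerivAt (curve γ) ((γ t).1 * C) t) :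
    IsParallelAlong (metricAI n) γ V ↔ (V 0).IsSymm ∧ ∀ t, V t = congrFlow C t (V 0) := by
  have hdiff : Differentiable ℝ (curve γ) := fun t => (hγ t).differentiableAt
  have heq (t : ℝ) : deriv (curve γ) t * (γ t).1⁻¹ * V t + V t * (γ t).1⁻¹ * deriv (curve γ) t =
      Cᵀ * V t + V t * C := by
    have hdet := (isUnit_iff_isUnit_det _).mp (γ t).2.isUnit
    rw [(hγ t).deriv, mul_assoc (V t), nonsing_inv_mul_cancel_left _ _ hdet,
      mul_eq_transpose_mul_of_hasDerivAt hγ, mul_nonsing_inv_cancel_right _ _ hdet]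
  simp only [isParallelAlong_metricAI_iff, heq]
  constructor
  · rintro ⟨-, hV, hVsymm, hV'⟩
    exact ⟨hVsymm 0, eq_congrFlow_of_hasDerivAt fun t => hV' t ▸ (hV t).hasDerivAt⟩
  · rintro ⟨hV₀, hV⟩
    have hderiv (t : ℝ) : HasDerivAt V ((1 / 2 : ℝ) • (Cᵀ * V t + V t * C)) t := by
      rw [funext hV]
      simpa only [congrFlow_zero] using hasDerivAt_congrFlow C (V 0) t
    refine ⟨hdiff, fun t => (hderiv t).differentiableAt, fun t => ?_, fun t => (hderiv t).deriv⟩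
    rw [hV]
    exact isSymm_congrFlow C t hV₀

/-! ### The Affine-Invariant metric: geodesics and gyroaddition -/

/-- The geodesic of the Affine-Invariant metric through `P` with initial velocity `P C`, where
`P C` is assumed to be symmetric. -/
def geodesicAI (P : SPD n) (C : Mat n) (t : ℝ) : SPD n :=
  ⟨congrFlow C t P.1, posDef_congrFlow C t P.2⟩

lemma coe_geodesicAI (P : SPD n) (C : Mat n) (t : ℝ) : (geodesicAI P C t).1 = congrFlow C t P.1 :=
  rfl

lemma geodesicAI_zero (P : SPD n) (C : Mat n) : geodesicAI P C 0 = P :=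
  Subtype.ext (congrFlow_zero C P.1)

lemma hasDerivAt_curve_geodesicAI {P : SPD n} {C : Mat n} (hPC : (P.1 * C).IsSymm) (t : ℝ) :
    HasDerivAt (curve (geodesicAI P C)) ((geodesicAI P C t).1 * C) t :=
  hasDerivAt_congrFlow_of_isSymm (isSymm_of_posDef P.2) hPC t

lemma deriv_curve_geodesicAI {P : SPD n} {C : Mat n} (hPC : (P.1 * C).IsSymm) (t : ℝ) :
    deriv (curve (geodesicAI P C)) t = congrFlow C t (P.1 * C) := by
  rw [(hasDerivAt_curve_geodesicAI hPC t).deriv, congrFlow_mul, coe_geodesicAI]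

lemma isGeodesic_geodesicAI {P : SPD n} {C : Mat n} (hPC : (P.1 * C).IsSymm) :
    IsGeodesic (metricAI n) (geodesicAI P C) := by
  refine (isParallelAlong_metricAI_iff_eq_congrFlow (hasDerivAt_curve_geodesicAI hPC)).mpr ?_
  simpa only [deriv_curve_geodesicAI hPC, congrFlow_zero, implies_true, and_true] using hPC

lemma hasDerivAt_curve_of_isGeodesic_metricAI {γ : ℝ → SPD n} (hγ : IsGeodesic (metricAI n) γ)
    (t : ℝ) : HasDerivAt (curve γ) ((γ t).1 * ((γ 0).1⁻¹ * deriv (curve γ) 0)) t := by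
  obtain ⟨hdiff, hdiff', -, hgeod⟩ := isParallelAlong_metricAI_iff.mp hγ
  have hconst (s : ℝ) : HasDerivAt (fun s => (γ s).1⁻¹ * deriv (curve γ) s) 0 s := by
    have hinv := hasDerivAt_nonsing_inv (hdiff s).hasDerivAt (γ s).2.isUnit
    refine (hinv.fun_mul (hdiff' s).hasDerivAt).congr_deriv ?_
    rw [hgeod s, ← two_smul ℝ, smul_smul, curve, one_div_mul_cancel two_ne_zero, one_smul]
    noncomm_ring
  have heq := is_const_of_deriv_eq_zero (fun s => (hconst s).differentiableAt)
    (fun s => (hconst s).deriv) t 0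
  rw [← heq, mul_nonsing_inv_cancel_left _ _ ((isUnit_iff_isUnit_det _).mp (γ t).2.isUnit)]
  exact (hdiff t).hasDerivAt

lemma eq_geodesicAI_of_hasDerivAt {γ : ℝ → SPD n} {C : Mat n}
    (hγ : ∀ t, HasDerivAt (curve γ) ((γ t).1 * C) t) : γ = geodesicAI (γ 0) C := by
  refine funext fun t => Subtype.ext ?_
  refine eq_congrFlow_of_hasDerivAt (V := curve γ) (fun s => (hγ s).congr_deriv ?_) t
  rw [curve, ← mul_eq_transpose_mul_of_hasDerivAt hγ]
  module

lemma isGeodesic_metricAI_iff {γ : ℝ → SPD n} :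
    IsGeodesic (metricAI n) γ ↔ ∃ (P : SPD n) (C : Mat n), (P.1 * C).IsSymm ∧
      γ = geodesicAI P C := by
  constructor
  · intro hγ
    have hderiv := hasDerivAt_curve_of_isGeodesic_metricAI hγ
    refine ⟨γ 0, (γ 0).1⁻¹ * deriv (curve γ) 0, ?_, eq_geodesicAI_of_hasDerivAt hderiv⟩
    exact (hderiv 0).deriv ▸ isSymm_deriv_curve hγ.1 0
  · rintro ⟨P, C, hPC, rfl⟩
    exact isGeodesic_geodesicAI hPC

lemma riemExp_metricAI {P : SPD n} {C : Mat n} (hPC : (P.1 * C).IsSymm) :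
    riemExp (metricAI n) P (P.1 * C) = geodesicAI P C 1 := by
  have hvelocity {Q : SPD n} {D : Mat n} (hQD : (Q.1 * D).IsSymm) :
      deriv (curve (geodesicAI Q D)) 0 = Q.1 * D := by
    rw [(hasDerivAt_curve_geodesicAI hQD 0).deriv, geodesicAI_zero]
  refine epsilon_eq fun R => ⟨?_, ?_⟩
  · rintro ⟨γ, hγ, hγ0, hγ', rfl⟩
    obtain ⟨Q, D, hQD, rfl⟩ := isGeodesic_metricAI_iff.mp hγ
    obtain rfl : Q = P := (geodesicAI_zero Q D).symm.trans hγ0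
    obtain rfl : D = C := Q.2.isUnit.mul_left_cancel ((hvelocity hQD).symm.trans hγ')
    rfl
  · rintro rfl
    exact ⟨_, isGeodesic_geodesicAI hPC, geodesicAI_zero P C, hvelocity hPC, rfl⟩

/-- The positive definite square root of an SPD matrix, in the form `exp (log P / 2)` in which it
arises from the parallel transport along the geodesic from the identity to `P`. -/
def spdSqrt (P : Mat n) : Mat n := exp ((1 / 2 : ℝ) • matLog P)

lemma isSymm_spdSqrt (P : Mat n) : (spdSqrt P).IsSymm := ((isSymm_matLog P).smul _).exp

lemma isUnit_spdSqrt (P : Mat n) : IsUnit (spdSqrt P) := Matrix.isUnit_exp _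

lemma congrFlow_matLog (P X : Mat n) :
    congrFlow (matLog P) 1 X = spdSqrt P * X * spdSqrt P := by
  rw [congrFlow, one_smul, ← spdSqrt, (isSymm_spdSqrt P).eq]

lemma exp_half_mul_exp_half (X : Mat n) :
    exp ((1 / 2 : ℝ) • X) * exp ((1 / 2 : ℝ) • X) = exp X := by
  rw [← Matrix.exp_add_of_commute _ _ (Commute.refl _), ← add_smul, add_halves, one_smul]

lemma spdSqrt_mul_self {P : Mat n} (hP : P.PosDef) : spdSqrt P * spdSqrt P = P := by
  rw [spdSqrt, exp_half_mul_exp_half, exp_matLog hP]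

lemma matLog_inv {P : Mat n} (hP : P.PosDef) : matLog P⁻¹ = -matLog P := by
  rw [← matLog_exp (isSymm_matLog P).neg, Matrix.exp_neg, exp_matLog hP]

lemma spdSqrt_inv {P : Mat n} (hP : P.PosDef) : spdSqrt P⁻¹ = (spdSqrt P)⁻¹ := by
  rw [spdSqrt, matLog_inv hP, smul_neg, Matrix.exp_neg, spdSqrt]

lemma geodesicAI_id {S : Mat n} (hS : S.IsSymm) : (geodesicAI (SPD.id n) S 1).1 = exp S := by
  rw [coe_geodesicAI, congrFlow, SPD.id, one_smul, Matrix.mul_one, (hS.smul _).exp.eq,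
    exp_half_mul_exp_half]

lemma geodesicAI_id_matLog (P : SPD n) : geodesicAI (SPD.id n) (matLog P.1) 1 = P :=
  Subtype.ext ((geodesicAI_id (isSymm_matLog P.1)).trans (exp_matLog P.2))

lemma isSymm_id_mul_iff {S : Mat n} : ((SPD.id n).1 * S).IsSymm ↔ S.IsSymm := by
  rw [SPD.id, Matrix.one_mul]

lemma riemLog_metricAI_id (P : SPD n) : riemLog (metricAI n) (SPD.id n) P = matLog P.1 := by
  have hexp {S : Mat n} (hS : S.IsSymm) :
      riemExp (metricAI n) (SPD.id n) S = geodesicAI (SPD.id n) S 1 := by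
    simpa only [SPD.id, Matrix.one_mul] using riemExp_metricAI (isSymm_id_mul_iff.mpr hS)
  refine epsilon_eq fun S => ⟨?_, ?_⟩
  · rintro ⟨hS, rfl⟩
    rw [hexp hS, geodesicAI_id hS, matLog_exp hS]
  · rintro rfl
    exact ⟨isSymm_matLog P.1, by rw [hexp (isSymm_matLog P.1), geodesicAI_id_matLog]⟩

lemma transport_metricAI_id (P : SPD n) {X : Mat n} (hX : X.IsSymm) :
    transport (metricAI n) (SPD.id n) P X = spdSqrt P.1 * X * spdSqrt P.1 := by
  rw [← congrFlow_matLog]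
  refine epsilon_eq fun W => ⟨?_, ?_⟩
  · rintro ⟨γ, V, hγ, hγ0, hγ1, hV, rfl, rfl⟩
    obtain ⟨Q, C, hQC, rfl⟩ := isGeodesic_metricAI_iff.mp hγ
    obtain rfl : Q = SPD.id n := (geodesicAI_zero Q C).symm.trans hγ0
    have hC : matLog P.1 = C := by
      rw [← hγ1, geodesicAI_id (isSymm_id_mul_iff.mp hQC), matLog_exp (isSymm_id_mul_iff.mp hQC)]
    rw [hC]
    exact ((isParallelAlong_metricAI_iff_eq_congrFlow
      (hasDerivAt_curve_geodesicAI hQC)).mp hV).2 1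
  · rintro rfl
    have hlog := isSymm_id_mul_iff.mpr (isSymm_matLog P.1)
    refine ⟨_, fun t => congrFlow (matLog P.1) t X, isGeodesic_geodesicAI hlog,
      geodesicAI_zero _ _, geodesicAI_id_matLog P,
      (isParallelAlong_metricAI_iff_eq_congrFlow (hasDerivAt_curve_geodesicAI hlog)).mpr ?_,
      congrFlow_zero _ X, rfl⟩
    simpa only [congrFlow_zero, implies_true, and_true] using hX

lemma gyroAdd_metricAI (P Q : SPD n) :
    (gyroAdd (metricAI n) P Q).1 = spdSqrt P.1 * Q.1 * spdSqrt P.1 := by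
  have hS := isSymm_matLog Q.1
  set R := spdSqrt P.1
  set S := matLog Q.1
  set T := spdSqrt Q.1 with hT_def
  have hR : R.IsSymm := isSymm_spdSqrt P.1
  have hT : T.IsSymm := isSymm_spdSqrt Q.1
  have hP : R * R = P.1 := spdSqrt_mul_self P.2
  have hQ : T * T = Q.1 := spdSqrt_mul_self Q.2
  have hunit : IsUnit R := isUnit_spdSqrt P.1
  have hdet : IsUnit R.det := (isUnit_iff_isUnit_det R).mp hunit
  have hvelocity : P.1 * (R⁻¹ * S * R) = R * S * R := by
    rw [← hP, mul_assoc, mul_assoc R⁻¹, mul_nonsing_inv_cancel_left _ _ hdet, ← mul_assoc]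
  have hexp : exp ((1 / 2 : ℝ) • (R⁻¹ * S * R)) = R⁻¹ * T * R := by
    rw [← Matrix.smul_mul, ← Matrix.mul_smul, Matrix.exp_conj' _ _ hunit, hT_def, spdSqrt]
  rw [gyroAdd, riemLog_metricAI_id, transport_metricAI_id P hS, ← hvelocity,
    riemExp_metricAI (hvelocity ▸ isSymm_mul_mul hR hS), coe_geodesicAI, congrFlow, one_smul, hexp,
    ← hP, ← hQ]
  simp only [transpose_mul, transpose_nonsing_inv, hR.eq, hT.eq, mul_assoc,
    mul_nonsing_inv_cancel_left _ _ hdet, nonsing_inv_mul_cancel_left _ _ hdet]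

lemma spdNorm_metricAI (P : SPD n) :
    spdNorm (metricAI n) P = Real.sqrt (matLog P.1 * matLog P.1).trace := by
  rw [spdNorm, spdInner, riemLog_metricAI_id, metricAI, SPD.id, inv_one, Matrix.one_mul,
    Matrix.mul_one]

lemma gyroAdd_metricAI_eq_id_iff (R P : SPD n) :
    gyroAdd (metricAI n) R P = SPD.id n ↔ R.1 = P.1⁻¹ := by
  rw [← Subtype.coe_inj, gyroAdd_metricAI, SPD.id, mul_eq_one_comm, ← mul_assoc,
    spdSqrt_mul_self R.2]
  exact ⟨fun h => (inv_eq_left_inv h).symm, fun h => h ▸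
    nonsing_inv_mul _ ((isUnit_iff_isUnit_det _).mp P.2.isUnit)⟩

lemma isAutomorphicInverse_metricAI :
    IsAutomorphicInverse (metricAI n) fun P => ⟨P.1⁻¹, P.2.inv⟩ where
  gyroAdd_eq_id_iff R P := by rw [gyroAdd_metricAI_eq_id_iff, Subtype.ext_iff]
  map_gyroAdd P Q := Subtype.ext <| by
    change (gyroAdd (metricAI n) P Q).1⁻¹ = _
    rw [gyroAdd_metricAI, gyroAdd_metricAI, spdSqrt_inv P.2, Matrix.mul_inv_rev,
      Matrix.mul_inv_rev, mul_assoc]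
  spdNorm_map P := by
    rw [spdNorm_metricAI, spdNorm_metricAI, matLog_inv P.2, neg_mul_neg]

/-! ### The three geometries -/

lemma exists_isAutomorphicInverse (k : Geometry) (n : ℕ) :
    ∃ inv, IsAutomorphicInverse (k.metric n) inv := by
  cases k with
  | le => exact ⟨_, isFlatParametrization_symExp.isAutomorphicInverse⟩
  | lc => exact ⟨_, isFlatParametrization_symLowerExp.isAutomorphicInverse⟩
  | ai => exact ⟨_, isAutomorphicInverse_metricAI⟩

end SPDGyro

end

theorem mainTheorem11 (k : SPDGyro.Geometry) (n : ℕ) :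
    (∀ P : SPDGyro.SPD n, ∃! R : SPDGyro.SPD n,
      SPDGyro.gyroAdd (k.metric n) R P = SPDGyro.SPD.id n) ∧
    SPDGyro.IsGyroisometry (k.metric n) (SPDGyro.gyroNeg (k.metric n)) := by
  obtain ⟨inv, hinv⟩ := SPDGyro.exists_isAutomorphicInverse k n
  exact ⟨hinv.existsUnique_gyroAdd_eq_id, hinv.isGyroisometry_gyroNeg⟩
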